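/- Let $p$ be a prime, $m,t\in\mathbb{R}$, and let $d^3x$ be the Haar measure on $\mathbb{Q}_p^3$ with $\mathbb{Z}_p^3$ of measure $1$. Let $\chi_p(x)=e^{2\pi i\{x\}_p}$ be the standard additive character, where $\{x\}_p$ is the $p$-adic fractional part, and let $x\cdot q=\sum_{k=1}^3 x_kq_k$ for $x,q\in\mathbb{Q}_p^3$. On the Hilbert space $\mathfrak{H}=L^2(\mathbb{Q}_p^3)\otimes\mathbb{C}^4$ let $\mathcal{F}$ be the unitary Fourier transform, given on integrable elements by $\hat\psi(q)=(\mathcal{F}\psi)(q)=\int_{\mathbb{Q}_p^3}\chi_p(q\cdot x)\psi(x)\,d^3x$. Let $\alpha_k=\begin{pmatrix}0&\sigma_k\\ \sigma_k&0\end{pmatrix}$ ($k=1,2,3$, with $\sigma_k$ the Pauli matrices) and $\beta=\mathrm{diag}(1,1,-1,-1)$ be the Dirac matrices, let $\boldsymbol{D}_{x_k}=\mathcal{F}^{-1}|q_k|_p\mathcal{F}$ be the Taibleson–Vladimirov operators on their natural domains, and let $$\boldsymbol{H}_0=\sum_{k=1}^3\alpha_k\boldsymbol{D}_{x_k}+\beta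 m$$ be the free $p$-adic Dirac operator, on the intersection of these domains (where it is self-adjoint). Let $e^{-i\boldsymbol{H}_0t}$ be the strongly continuous unitary group with generator $-i\boldsymbol{H}_0$. Put $$h(q)=\sum_{k=1}^3|q_k|_p\,\alpha_k+m\beta,\qquad \lambda(q)=\sqrt{|q_1|_p^2+|q_2|_p^2+|q_3|_p^2+m^2},\qquad u(q)=\frac{(m+\lambda(q))\mathbf 1+\beta\sum_k|q_k|_p\alpha_k}{\sqrt{2\lambda(q)(m+\lambda(q))}},$$ the last being a unitary matrix for almost every $q$. Put $\mathcal{W}=u\mathcal{F}$, and let $\mathcal{P}_{pos}=\mathcal{W}^{-1}\tfrac12(\mathbf 1+\beta)\mathcal{W}$ and $\mathcal{P}_{neg}=\mathcal{W}^{-1}\tfrac12(\mathbf 1-\beta)\mathcal{W}$ be the projections onto the positive and negative energy subspaces. Let $\psi=(\psi_1,\dots,\psi_4):\mathbb{Q}_p^3\to\mathbb{C}^4$ have all components in the Lizorkin space of locally constant compactly supported functions with zero integral. Then, with upper signs for $pos$ and lower signs for $neg$, for almost every $x\in\mathbb{Q}_p^3$, $$\bigl(e^{-i\boldsymbol{H}_0t}\mathcal{P}_{\substack{pos\\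 neg}}\psi\bigr)(x)=\int_{\mathbb{Q}_p^3}\chi_p(-x\cdot q)\,e^{\mp i\lambda(q)t}\,\frac{\lambda(q)\pm h(q)}{2\lambda(q)}\,\hat\psi(q)\,d^3q ,$$ where the integral converges absolutely for every $x$. Equivalently, it is the oscillatory kernel integral $$\int_{\mathbb{Q}_p^3}\Bigl\{\int_{\mathbb{Q}_p^3}\chi_p((x-y)\cdot q)\,e^{\mp i\lambda(q)t}\,\frac{\lambda(q)\pm h(q)}{2\lambda(q)}\,d^3q\Bigr\}\psi(y)\,d^3y ,$$ understood as the limit for $\epsilon\to0^+$ of the integrals with $t$ replaced by $t\mp i\epsilon$, that is, with an additional factor $e^{-\epsilon\lambda(q)}$ in the inner integrand: for each $\epsilon>0$ the inner integral (for every $y$) and the outer integral converge absolutely, and for every $x$ the limit exists and equals the preceding integral. -/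

import Mathlib

open MeasureTheory Filter Topology

namespace PadicDirac

/-! ### The field of `p`-adic numbers and the space `ℚ_p³` -/

noncomputable instance instMeasurableSpacePadic (p : ℕ) [Fact p.Prime] : MeasurableSpace ℚ_[p] := borel _

instance instBorelSpacePadic (p : ℕ) [Fact p.Prime] : BorelSpace ℚ_[p] := ⟨rfl⟩

/-- The space `ℚ_p³`; its norm is the maximum of the norms of the coordinates. -/
abbrev Space (p : ℕ) [Fact p.Prime] : Type := Fin 3 → ℚ_[p]

/-- The unit ball `ℤ_p³`, a compact set with non-empty interior. -/
def unitBall (p : ℕ) [Fact p.Prime] : TopologicalSpace.PositiveCompacts (Space p) where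
  carrier := Metric.closedBall 0 1
  isCompact' := isCompact_closedBall 0 1
  interior_nonempty' :=
    ⟨0, mem_interior.mpr ⟨Metric.ball 0 1, Metric.ball_subset_closedBall, Metric.isOpen_ball,
      Metric.mem_ball_self one_pos⟩⟩

/-- The Haar measure on `ℚ_p³` giving `ℤ_p³` the measure `1`. -/
noncomputable def haar (p : ℕ) [Fact p.Prime] : Measure (Space p) :=
  Measure.addHaarMeasure (unitBall p)

noncomputable instance instIsAddHaarMeasureHaar (p : ℕ) [Fact p.Prime] :
    (haar p).IsAddHaarMeasure := by
  unfold haar; infer_instance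

/-! ### The additive character -/

lemma scale_norm_le_one {p : ℕ} [Fact p.Prime] (x : ℚ_[p]) :
    ‖(p : ℚ_[p]) ^ (-x.valuation).toNat * x‖ ≤ 1 := by
  rcases eq_or_ne x 0 with rfl | hx
  · simp
  have hp : (1 : ℝ) < p := by exact_mod_cast (Fact.out : p.Prime).one_lt
  rw [norm_mul, norm_pow, Padic.norm_p, Padic.norm_eq_zpow_neg_valuation hx, inv_pow,
    ← zpow_natCast, ← zpow_neg, ← zpow_add₀ (by positivity)]
  apply zpow_le_one_of_nonpos₀ hp.le
  have := Int.self_le_toNat (-x.valuation)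
  omega

/-- The fractional part `{x}_p ∈ [0, 1)`.  With `n = max(0, -ord x)`, the number `pⁿ x` is a
`p`-adic integer; its residue modulo `pⁿ`, taken in `{0, …, pⁿ - 1}`, is the sum of its first `n`
digits, and dividing by `pⁿ` leaves the digits of `x` with negative exponent. -/
noncomputable def fractPart {p : ℕ} [Fact p.Prime] (x : ℚ_[p]) : ℚ :=
  ((PadicInt.toZModPow (-x.valuation).toNat
      (⟨(p : ℚ_[p]) ^ (-x.valuation).toNat * x, scale_norm_le_one x⟩ : ℤ_[p])).val : ℚ)
    / (p : ℚ) ^ (-x.valuation).toNat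

/-- The standard additive character `χ_p(x) = exp(2πi {x}_p)`. -/
noncomputable def chi {p : ℕ} [Fact p.Prime] (x : ℚ_[p]) : ℂ :=
  Complex.exp (2 * Real.pi * Complex.I * ((fractPart x : ℚ) : ℂ))

lemma fractPart_of_norm_le_one {p : ℕ} [Fact p.Prime] {x : ℚ_[p]} (hx : ‖x‖ ≤ 1) :
    fractPart x = 0 := by
  have h0 : (-x.valuation).toNat = 0 := by
    have := (Padic.norm_le_one_iff_val_nonneg x).mp hx
    omega
  have key : ∀ (n : ℕ) (y : ℤ_[p]), n = 0 →
      ((PadicInt.toZModPow n y).val : ℚ) / (p : ℚ) ^ n = 0 := by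
    rintro n y rfl
    have h1 : (PadicInt.toZModPow 0 y).val < p ^ 0 := ZMod.val_lt _
    have h2 : (PadicInt.toZModPow 0 y).val = 0 := Nat.lt_one_iff.mp (h1.trans_eq (pow_zero p))
    rw [h2, Nat.cast_zero, zero_div]
  exact key _ _ h0

lemma fractPart_add_of_norm_le_one {p : ℕ} [Fact p.Prime] (x : ℚ_[p]) {z : ℚ_[p]}
    (hz : ‖z‖ ≤ 1) : fractPart (x + z) = fractPart x := by
  by_cases hx : ‖x‖ ≤ 1
  · rw [fractPart_of_norm_le_one hx,
      fractPart_of_norm_le_one ((Padic.nonarchimedean x z).trans (max_le hx hz))]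
  push Not at hx
  have hx0 : x ≠ 0 := by
    rintro rfl
    simp at hx
    linarith
  have hn : ‖x + z‖ = ‖x‖ := by
    have hne : ‖x‖ ≠ ‖z‖ := (hz.trans_lt hx).ne'
    rw [Padic.add_eq_max_of_ne hne]
    exact max_eq_left (hz.trans hx.le)
  have hxz0 : x + z ≠ 0 := by
    intro h
    rw [h, norm_zero] at hn
    exact hx0 (norm_eq_zero.mp hn.symm)
  have hp : (1 : ℝ) < p := by exact_mod_cast (Fact.out : p.Prime).one_lt
  have hv : (x + z).valuation = x.valuation := by
    rw [Padic.norm_eq_zpow_neg_valuation hx0, Padic.norm_eq_zpow_neg_valuation hxz0] at hn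
    have := zpow_right_injective₀ (by linarith) hp.ne' hn
    omega
  have key : ∀ (n n' : ℕ) (a b : ℤ_[p]), n = n' → (a : ℚ_[p]) = b + (p : ℚ_[p]) ^ n * z →
      ((PadicInt.toZModPow n a).val : ℚ) / (p : ℚ) ^ n
        = ((PadicInt.toZModPow n' b).val : ℚ) / (p : ℚ) ^ n' := by
    rintro n _ a b rfl hab
    obtain ⟨w, hw⟩ : ∃ w : ℤ_[p], (w : ℚ_[p]) = z := ⟨⟨z, hz⟩, rfl⟩
    have hab' : a = b + (p : ℤ_[p]) ^ n * w := by
      apply Subtype.ext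
      push_cast
      rw [hab, hw]
    have hp0 : ((p : ZMod (p ^ n))) ^ n = 0 := by
      rw [← Nat.cast_pow, ZMod.natCast_self]
    rw [hab', map_add, map_mul, map_pow, map_natCast, hp0, zero_mul, add_zero]
  refine key _ _ _ _ (by rw [hv]) ?_
  change (p : ℚ_[p]) ^ (-(x + z).valuation).toNat * (x + z) = (p : ℚ_[p]) ^ _ * x + _
  rw [hv, mul_add]

lemma continuous_chi {p : ℕ} [Fact p.Prime] : Continuous (chi : ℚ_[p] → ℂ) := by
  refine IsLocallyConstant.continuous ((IsLocallyConstant.iff_eventually_eq _).mpr fun x => ?_)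
  filter_upwards [Metric.closedBall_mem_nhds x one_pos] with y hy
  have h : fractPart y = fractPart x := by
    have := fractPart_add_of_norm_le_one x (z := y - x) (by simpa [dist_eq_norm] using hy)
    rwa [add_sub_cancel] at this
  simp [chi, h]

lemma norm_chi {p : ℕ} [Fact p.Prime] (x : ℚ_[p]) : ‖chi x‖ = 1 := by
  have h : chi x = Complex.exp (((2 * Real.pi * (fractPart x : ℚ) : ℝ) : ℂ) * Complex.I) := by
    unfold chi
    congr 1
    push_cast
    ring
  rw [h, Complex.norm_exp_ofReal_mul_I]

/-! ### Spinor-valued functions and the Fourier transform -/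

/-- The space `ℂ⁴` of spinors. -/
abbrev Spinor : Type := EuclideanSpace ℂ (Fin 4)

/-- The linear operator on `ℂ⁴` given by a matrix. -/
noncomputable abbrev matOp (M : Matrix (Fin 4) (Fin 4) ℂ) : Spinor →L[ℂ] Spinor :=
  Matrix.toEuclideanCLM (𝕜 := ℂ) M

/-- The Hilbert space `𝔥 = L²(ℚ_p³) ⊗ ℂ⁴`. -/
abbrev StateSpace (p : ℕ) [Fact p.Prime] : Type := Lp Spinor 2 (haar p)

/-- The Fourier transform `∫ χ_p(q · x) f(x) d³x` of an integrable function. -/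
noncomputable def fourier {p : ℕ} [Fact p.Prime] (f : Space p → Spinor) (q : Space p) : Spinor :=
  ∫ x, chi (q ⬝ᵥ x) • f x ∂(haar p)

lemma integrable_chi_smul {p : ℕ} [Fact p.Prime] {f : Space p → Spinor}
    (hf : Integrable f (haar p)) (q : Space p) :
    Integrable (fun x => chi (q ⬝ᵥ x) • f x) (haar p) := by
  have hc : Continuous fun x : Space p => chi (q ⬝ᵥ x) := continuous_chi.comp (by fun_prop)
  refine (integrable_norm_iff (hc.aestronglyMeasurable.smul hf.aestronglyMeasurable)).mp ?_
  simpa [norm_smul, norm_chi] using hf.norm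

lemma fourier_add {p : ℕ} [Fact p.Prime] {f g : Space p → Spinor}
    (hf : Integrable f (haar p)) (hg : Integrable g (haar p)) :
    fourier (f + g) = fourier f + fourier g := by
  funext q
  simp only [fourier, Pi.add_apply, smul_add]
  exact integral_add (integrable_chi_smul hf q) (integrable_chi_smul hg q)

lemma fourier_smul {p : ℕ} [Fact p.Prime] (c : ℂ) (f : Space p → Spinor) :
    fourier (c • f) = c • fourier f := by
  funext q
  simp only [fourier, Pi.smul_apply, smul_comm _ c]
  exact integral_smul c _

lemma fourier_congr {p : ℕ} [Fact p.Prime] {f g : Space p → Spinor} (h : f =ᵐ[haar p] g) :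
    fourier f = fourier g := by
  funext q
  refine integral_congr_ae ?_
  filter_upwards [h] with x hx
  rw [hx]

/-- The dense subspace of integrable elements of `𝔥` (whose Fourier transform is automatically
square-integrable). -/
noncomputable def integrableStates (p : ℕ) [Fact p.Prime] : Submodule ℂ (StateSpace p) where
  carrier := {f | Integrable f (haar p) ∧ MemLp (fourier f) 2 (haar p)}
  add_mem' := by
    rintro f g ⟨hf, hf'⟩ ⟨hg, hg'⟩
    refine ⟨(hf.add hg).congr (Lp.coeFn_add f g).symm, ?_⟩
    rw [fourier_congr (Lp.coeFn_add f g), fourier_add hf hg]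
    exact hf'.add hg'
  zero_mem' := by
    refine ⟨(integrable_zero _ _ _).congr (Lp.coeFn_zero _ _ _).symm, ?_⟩
    have h : fourier (p := p) (0 : Space p → Spinor) = 0 := by
      funext q
      simp [fourier]
    rw [fourier_congr (Lp.coeFn_zero Spinor 2 (haar p)), h]
    exact MemLp.zero
  smul_mem' := by
    rintro c f ⟨hf, hf'⟩
    refine ⟨(hf.smul c).congr (Lp.coeFn_smul c f).symm, ?_⟩
    rw [fourier_congr (Lp.coeFn_smul c f), fourier_smul]
    exact hf'.const_smul c

/-- The Fourier integral, as a linear map on the integrable elements of `𝔥`. -/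
noncomputable def fourierIntegrable (p : ℕ) [Fact p.Prime] :
    integrableStates p →ₗ[ℂ] StateSpace p where
  toFun f := f.2.2.toLp _
  map_add' f g := by
    rw [← MemLp.toLp_add]
    refine MemLp.toLp_congr _ _ (Eventually.of_forall fun q => congrFun ?_ q)
    rw [← fourier_add f.2.1 g.2.1]
    exact fourier_congr (Lp.coeFn_add _ _)
  map_smul' c f := by
    rw [RingHom.id_apply, ← MemLp.toLp_const_smul]
    refine MemLp.toLp_congr _ _ (Eventually.of_forall fun q => congrFun ?_ q)
    rw [← fourier_smul]
    exact fourier_congr (Lp.coeFn_smul _ _)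

/-- The Fourier transform `ℱ` on `𝔥`: the continuous extension of the Fourier integral. -/
noncomputable def fourierL2 (p : ℕ) [Fact p.Prime] : StateSpace p →L[ℂ] StateSpace p :=
  (fourierIntegrable p).extendOfNorm (integrableStates p).subtype

/-- The inverse `ℱ⁻¹` of the Fourier transform on `𝔥`. -/
noncomputable def fourierL2Inv (p : ℕ) [Fact p.Prime] : StateSpace p →L[ℂ] StateSpace p :=
  (fourierL2 p).inverse

/-! ### The Dirac matrices and the free Hamiltonian -/

/-- The Dirac matrices `α₁, α₂, α₃` (off-diagonal blocks: the Pauli matrices). -/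
noncomputable def alpha : Fin 3 → Matrix (Fin 4) (Fin 4) ℂ :=
  ![!![0, 0, 0, 1; 0, 0, 1, 0; 0, 1, 0, 0; 1, 0, 0, 0],
    !![0, 0, 0, -Complex.I; 0, 0, Complex.I, 0; 0, -Complex.I, 0, 0; Complex.I, 0, 0, 0],
    !![0, 0, 1, 0; 0, 0, 0, -1; 1, 0, 0, 0; 0, -1, 0, 0]]

/-- The Dirac matrix `β`. -/
noncomputable def beta : Matrix (Fin 4) (Fin 4) ℂ := Matrix.diagonal ![1, 1, -1, -1]

/-- The constant matrix `M` acting on `𝔥`. -/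
noncomputable def constOp (p : ℕ) [Fact p.Prime] (M : Matrix (Fin 4) (Fin 4) ℂ) :
    StateSpace p →L[ℂ] StateSpace p :=
  (matOp M).compLpL 2 (haar p)

lemma mul_add_ae {p : ℕ} [Fact p.Prime] (M : Space p → Spinor →L[ℂ] Spinor) (f g : StateSpace p) :
    (fun q => M q ((f + g : StateSpace p) q)) =ᵐ[haar p]
      ((fun q => M q (f q)) + fun q => M q (g q)) := by
  filter_upwards [Lp.coeFn_add f g] with q hq
  rw [hq, Pi.add_apply, Pi.add_apply, _root_.map_add]

lemma mul_smul_ae {p : ℕ} [Fact p.Prime] (M : Space p → Spinor →L[ℂ] Spinor) (c : ℂ)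
    (f : StateSpace p) :
    (fun q => M q ((c • f : StateSpace p) q)) =ᵐ[haar p] c • fun q => M q (f q) := by
  filter_upwards [Lp.coeFn_smul c f] with q hq
  rw [hq, Pi.smul_apply, Pi.smul_apply, _root_.map_smul]

lemma mul_zero_ae {p : ℕ} [Fact p.Prime] (M : Space p → Spinor →L[ℂ] Spinor) :
    (fun q => M q ((0 : StateSpace p) q)) =ᵐ[haar p] (fun _ => 0 : Space p → Spinor) := by
  filter_upwards [Lp.coeFn_zero Spinor 2 (haar p)] with q hq
  rw [hq, Pi.zero_apply, _root_.map_zero]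

/-- Multiplication by the operator-valued function `M`, on its natural domain
`{f ∈ 𝔥 | M f ∈ 𝔥}`. -/
noncomputable def mulOp {p : ℕ} [Fact p.Prime] (M : Space p → Spinor →L[ℂ] Spinor) :
    StateSpace p →ₗ.[ℂ] StateSpace p where
  domain :=
    { carrier := {f | MemLp (fun q => M q (f q)) 2 (haar p)}
      add_mem' := fun hf hg => (memLp_congr_ae (mul_add_ae M _ _)).mpr (hf.add hg)
      zero_mem' := (memLp_congr_ae (mul_zero_ae M)).mpr MemLp.zero
      smul_mem' := fun c _ hf => (memLp_congr_ae (mul_smul_ae M c _)).mpr (hf.const_smul c) }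
  toFun :=
    { toFun := fun f => MemLp.toLp (fun q => M q (f.1 q)) f.2
      map_add' := fun f g =>
        (MemLp.toLp_congr _ (f.2.add g.2) (mul_add_ae M f.1 g.1)).trans
          (MemLp.toLp_add f.2 g.2)
      map_smul' := fun c f =>
        (MemLp.toLp_congr _ (f.2.const_smul c) (mul_smul_ae M c f.1)).trans
          (MemLp.toLp_const_smul c f.2) }

/-- The Taibleson-Vladimirov operator `D_{x_k} = ℱ⁻¹ |q_k|_p ℱ`, acting componentwise on its natural
domain `{φ ∈ 𝔥 | |q_k|_p ℱφ ∈ 𝔥}`. -/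
noncomputable def vladimirov (p : ℕ) [Fact p.Prime] (k : Fin 3) :
    StateSpace p →ₗ.[ℂ] StateSpace p :=
  let N : StateSpace p →ₗ.[ℂ] StateSpace p :=
    mulOp fun q => (‖q k‖ : ℂ) • ContinuousLinearMap.id ℂ Spinor
  { domain := N.domain.comap (fourierL2 p).toLinearMap
    toFun := (fourierL2Inv p).toLinearMap ∘ₗ N.toFun ∘ₗ
      (fourierL2 p).toLinearMap.submoduleComap N.domain }

/-- The free Dirac Hamiltonian `H₀ = α₁ D_{x₁} + α₂ D_{x₂} + α₃ D_{x₃} + m β`, on the intersection of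
the domains of the `D_{x_k}`, which is `{φ ∈ 𝔥 | max(1, ‖q‖) ℱφ ∈ 𝔥}`. -/
noncomputable def hamiltonian (p : ℕ) [Fact p.Prime] (m : ℝ) : StateSpace p →ₗ.[ℂ] StateSpace p :=
  (constOp p (alpha 0)).toLinearMap.compPMap (vladimirov p 0)
    + (constOp p (alpha 1)).toLinearMap.compPMap (vladimirov p 1)
    + (constOp p (alpha 2)).toLinearMap.compPMap (vladimirov p 2)
    + (constOp p ((m : ℂ) • beta)).toLinearMap.toPMap ⊤

/-! ### The unitary group generated by an operator -/

/-- `U` is a strongly continuous one-parameter unitary group on `H` whose generator is `-iA`. -/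
structure IsUnitaryGroupOf {H : Type*} [NormedAddCommGroup H] [InnerProductSpace ℂ H]
    (A : H →ₗ.[ℂ] H) (U : ℝ → H ≃ₗᵢ[ℂ] H) : Prop where
  map_add : ∀ (s t : ℝ) (φ : H), U (s + t) φ = U s (U t φ)
  continuous : ∀ φ : H, Continuous fun t => U t φ
  generator : ∀ φ η : H, (φ, η) ∈ A.graph ↔ HasDerivAt (fun t => U t φ) (-Complex.I • η) 0

open Classical in
/-- The unitary group `e^{-itA}` generated by `A` (for a self-adjoint operator `A` there is exactly
one, by Stone's theorem; if there is none, the value is the identity). -/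
noncomputable def expNegI {H : Type*} [NormedAddCommGroup H] [InnerProductSpace ℂ H]
    (A : H →ₗ.[ℂ] H) : ℝ → H ≃ₗᵢ[ℂ] H :=
  if h : ∃ U, IsUnitaryGroupOf A U then h.choose else fun _ => LinearIsometryEquiv.refl ℂ H

/-! ### The symbol of the Hamiltonian and the energy projections -/

/-- The matrix `α · |q| = ∑ₖ |q_k|_p αₖ`. -/
noncomputable def alphaDot {p : ℕ} [Fact p.Prime] (q : Space p) : Matrix (Fin 4) (Fin 4) ℂ :=
  ∑ k, (‖q k‖ : ℂ) • alpha k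

/-- The symbol `h(q) = α · |q| + m β` of the Hamiltonian. -/
noncomputable def symbol {p : ℕ} [Fact p.Prime] (m : ℝ) (q : Space p) :
    Matrix (Fin 4) (Fin 4) ℂ :=
  alphaDot q + (m : ℂ) • beta

/-- The energy `λ(q) = √(|q₁|² + |q₂|² + |q₃|² + m²)`. -/
noncomputable def energy {p : ℕ} [Fact p.Prime] (m : ℝ) (q : Space p) : ℝ :=
  Real.sqrt (∑ k, ‖q k‖ ^ 2 + m ^ 2)

/-- The unitary matrix `u(q) = ((m + λ(q)) 1 + β α·|q|) / √(2 λ(q) (m + λ(q)))` diagonalizing `h(q)`.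
It is defined for almost every `q`: the denominator vanishes at most at `q = 0`. -/
noncomputable def diagonalizer {p : ℕ} [Fact p.Prime] (m : ℝ) (q : Space p) :
    Matrix (Fin 4) (Fin 4) ℂ :=
  ((Real.sqrt (2 * energy m q * (m + energy m q)) : ℝ) : ℂ)⁻¹ •
    (((m + energy m q : ℝ) : ℂ) • (1 : Matrix (Fin 4) (Fin 4) ℂ) + beta * alphaDot q)

open Classical in
/-- Multiplication of an element of `𝔥` by a bounded matrix-valued function (set to `0` if the
product is not in `𝔥`). -/
noncomputable def mulMatrix {p : ℕ} [Fact p.Prime] (M : Space p → Matrix (Fin 4) (Fin 4) ℂ)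
    (f : StateSpace p) : StateSpace p :=
  if hf : f ∈ (mulOp fun q => matOp (M q)).domain then (mulOp fun q => matOp (M q)) ⟨f, hf⟩ else 0

/-- The transformation `𝒲 = u ℱ` of `𝔥`. -/
noncomputable def diagTransform {p : ℕ} [Fact p.Prime] (m : ℝ) (ψ : StateSpace p) : StateSpace p :=
  mulMatrix (diagonalizer m) (fourierL2 p ψ)

/-- The inverse `𝒲⁻¹ = ℱ⁻¹ u⁻¹`. -/
noncomputable def diagTransformInv {p : ℕ} [Fact p.Prime] (m : ℝ) (ω : StateSpace p) :
    StateSpace p :=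
  fourierL2Inv p (mulMatrix (fun q => (diagonalizer m q)⁻¹) ω)

/-- The projection `𝒲⁻¹ ½(1 + σβ) 𝒲` onto the subspace of positive (`σ = 1`) or negative
(`σ = -1`) energies. -/
noncomputable def energyProj {p : ℕ} [Fact p.Prime] (m σ : ℝ) (ψ : StateSpace p) : StateSpace p :=
  diagTransformInv m
    (constOp p ((1 / 2 : ℂ) • (1 + (σ : ℂ) • beta)) (diagTransform m ψ))

/-! ### The Lizorkin space -/

/-- The Lizorkin space `ℒ(ℚ_p³)` of the second kind: locally constant, compactly supported
functions with zero integral. -/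
structure IsLizorkin {p : ℕ} [Fact p.Prime] (φ : Space p → ℂ) : Prop where
  locallyConstant : IsLocallyConstant φ
  compactSupport : HasCompactSupport φ
  integral_eq_zero : ∫ x, φ x ∂(haar p) = 0

lemma memLp_of_isLizorkin {p : ℕ} [Fact p.Prime] {ψ : Space p → Spinor}
    (hψ : ∀ i, IsLizorkin fun x => ψ x i) : MemLp ψ 2 (haar p) := by
  rw [memLp_piLp_iff]
  exact fun i =>
    (hψ i).locallyConstant.continuous.memLp_of_hasCompactSupport (hψ i).compactSupport

/-! ### The integrands -/

/-- The operator `½ (1 + σ h(q) / λ(q)) = (λ(q) + σ h(q)) / (2 λ(q))` on `ℂ⁴`. -/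
noncomputable def projSymbol {p : ℕ} [Fact p.Prime] (m σ : ℝ) (q : Space p) : Spinor →L[ℂ] Spinor :=
  ((2 * energy m q : ℝ) : ℂ)⁻¹ • matOp ((energy m q : ℂ) • 1 + (σ : ℂ) • symbol m q)

/-- The kernel `∫ χ_p(z · q) e^{-iσλ(q)t} e^{-ελ(q)} (λ(q) + σ h(q)) / (2 λ(q)) d³q` at the complex
time `t - iσε`, where `e^{-iσλ(q)(t - iσε)} = e^{-iσλ(q)t} e^{-ελ(q)}`. -/
noncomputable def kernelIntegrand {p : ℕ} [Fact p.Prime] (m σ t ε : ℝ) (z q : Space p) :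
    Spinor →L[ℂ] Spinor :=
  (chi (z ⬝ᵥ q) * Complex.exp (-Complex.I * σ * energy m q * t - ε * energy m q)) •
    projSymbol m σ q

end PadicDirac

namespace PadicDirac

/-! ### Additivity of the character -/

section Character

variable {p : ℕ} [Fact p.Prime]

/-! In momentum space every operator is multiplication by a matrix function. The transform `ℱ`
carries `H₀` to multiplication by `h(q)`. The Dirac relations give `h(q)² = λ(q)²`, so `Π_σ = (λ +
σh)/(2λ)` projects onto the eigenspace `h = σλ` for `q ≠ 0`, and `e^{-ith(q)}` acts there as
`e^{-iσλ(q)t}`. Since `u*βu = h/λ`, the energy projection becomes multiplication by `Π_σ`. Hence the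
evolved state has transform `e^{-iσλt} Π_σ ψ̂`. As `ψ̂` is locally constant with compact support,
this amplitude is both integrable and square-integrable, and its inverse transform is almost
everywhere an absolutely convergent integral (`expNegI_energyProj_ae`).

Three facts support this. The first is Plancherel and inversion. The character is trivial on `ℤ_p`
but not at `p⁻¹`, so Fourier transformation exchanges support and invariance radii of
Schwartz-Bruhat functions, and averaging over small balls gives inversion
(`IsSchwartzBruhat.fourier_fourier`); density and duality extend it to `L²`. The second is that
`e^{-itH₀}` really is multiplication by `e^{-ith(q)}`. This needs a group with exactly the right
generator (`isUnitaryGroupOf_expMul`), equality of the domains (`mem_graph_hamiltonian`) and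
uniqueness (`IsUnitaryGroupOf.unique`), because `expNegI` is defined by choice. The third is the
matrix algebra of `u` and `h`.

For the kernel form, `λ(q) ≥ ‖q‖` makes `e^{-ελ}` integrable: the volume of the ball of radius `pⁿ`
grows only geometrically in `n`. Fubini and the reflection `q ↦ -q` turn the regularized kernel
integral into the momentum integral with the factor `e^{-ελ}` (`integral_kernel_apply`), and
dominated convergence with majorant `‖ψ̂‖` removes it. -/

lemma exists_fractPart_eq_div (x : ℚ_[p]) :
    ∃ a n : ℕ, fractPart x = (a : ℚ) / (p : ℚ) ^ n ∧
      ‖x - (a : ℚ_[p]) / (p : ℚ_[p]) ^ n‖ ≤ 1 := by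
  have hp0 : (p : ℚ_[p]) ≠ 0 := by exact_mod_cast (Fact.out : p.Prime).ne_zero
  refine ⟨_, _, rfl, ?_⟩
  set n := (-x.valuation).toNat with hn
  set y : ℤ_[p] := ⟨(p : ℚ_[p]) ^ n * x, scale_norm_le_one x⟩ with hy
  set a := (PadicInt.toZModPow n y).val with ha
  -- The integer `a` is congruent to `pⁿx` modulo `pⁿ`, and the kernel of the reduction is the ideal
  -- generated by `pⁿ`.
  have hmem : y - (a : ℤ_[p]) ∈ RingHom.ker (PadicInt.toZModPow (p := p) n) := by
    rw [RingHom.mem_ker, map_sub, map_natCast, ha, ZMod.natCast_zmod_val, sub_self]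
  rw [PadicInt.ker_toZModPow, Ideal.mem_span_singleton'] at hmem
  obtain ⟨z, hz⟩ := hmem
  have hz' : (z : ℚ_[p]) * (p : ℚ_[p]) ^ n = (p : ℚ_[p]) ^ n * x - a := by
    have : ((z * (p : ℤ_[p]) ^ n : ℤ_[p]) : ℚ_[p]) = ((y - (a : ℤ_[p]) : ℤ_[p]) : ℚ_[p]) := by
      rw [hz]
    rwa [PadicInt.coe_mul, PadicInt.coe_pow, PadicInt.coe_natCast, PadicInt.coe_sub,
      PadicInt.coe_natCast] at this
  have : x - (a : ℚ_[p]) / (p : ℚ_[p]) ^ n = z := by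
    field_simp
    linear_combination -hz'
  rw [this]
  exact z.2

/-- The rational number `{x+y} - {x} - {y}` has a power of `p` as denominator and is also a `p`-adic
integer, so it is an integer. -/
lemma fractPart_add_eq_add_int (x y : ℚ_[p]) :
    ∃ k : ℤ, fractPart (x + y) = fractPart x + fractPart y + k := by
  have hp0 : (p : ℚ_[p]) ≠ 0 := by exact_mod_cast (Fact.out : p.Prime).ne_zero
  have hp0' : (p : ℚ) ≠ 0 := by exact_mod_cast (Fact.out : p.Prime).ne_zero
  have hp1 : (0 : ℝ) < p := by exact_mod_cast (Fact.out : p.Prime).pos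
  obtain ⟨a, i, hx, hx'⟩ := exists_fractPart_eq_div x
  obtain ⟨b, j, hy, hy'⟩ := exists_fractPart_eq_div y
  obtain ⟨c, l, hxy, hxy'⟩ := exists_fractPart_eq_div (x + y)
  rw [hx, hy, hxy]
  -- The numerator of `{x+y} - {x} - {y}` over the common denominator `p^(i+j+l)`.
  set r : ℤ := (c : ℤ) * p ^ (i + j) - a * p ^ (j + l) - b * p ^ (i + l) with hr
  have h1 : ‖(r : ℚ_[p]) / (p : ℚ_[p]) ^ (i + j + l)‖ ≤ 1 := by
    have e : (r : ℚ_[p]) / (p : ℚ_[p]) ^ (i + j + l) =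
        (x - a / (p : ℚ_[p]) ^ i) + (y - b / (p : ℚ_[p]) ^ j)
          - (x + y - c / (p : ℚ_[p]) ^ l) := by
      rw [hr]
      push_cast
      field_simp
      ring
    rw [e]
    rw [sub_eq_add_neg]
    refine (IsUltrametricDist.norm_add_le_max _ _).trans (max_le ?_ (by rwa [norm_neg]))
    exact (IsUltrametricDist.norm_add_le_max _ _).trans (max_le hx' hy')
  have h2 : ‖(r : ℚ_[p])‖ ≤ (p : ℝ) ^ (-((i + j + l : ℕ) : ℤ)) := by
    rw [norm_div, norm_pow, Padic.norm_p, inv_pow] at h1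
    rwa [div_le_one (by positivity), ← zpow_natCast, ← zpow_neg] at h1
  obtain ⟨k, hk⟩ := (Padic.norm_int_le_pow_iff_dvd r (i + j + l)).mp h2
  refine ⟨k, ?_⟩
  have hk' : (c : ℚ) * p ^ (i + j) - a * p ^ (j + l) - b * p ^ (i + l) =
      p ^ (i + j + l) * k := by
    have := congrArg (fun w : ℤ => (w : ℚ)) (hr ▸ hk)
    push_cast at this
    exact this
  field_simp
  linear_combination hk'

lemma chi_add (x y : ℚ_[p]) : chi (x + y) = chi x * chi y := by
  obtain ⟨k, hk⟩ := fractPart_add_eq_add_int x y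
  unfold chi
  rw [← Complex.exp_add, hk, Complex.exp_eq_exp_iff_exists_int]
  exact ⟨k, by push_cast; ring⟩

lemma chi_of_norm_le_one {x : ℚ_[p]} (hx : ‖x‖ ≤ 1) : chi x = 1 := by
  simp [chi, fractPart_of_norm_le_one hx]

lemma chi_zero : chi (0 : ℚ_[p]) = 1 := chi_of_norm_le_one (by simp)

/-- A value `1` would make the fractional part of `p⁻¹` an integer, and then `p⁻¹` would be a
`p`-adic integer. -/
lemma chi_inv_p_ne_one : chi ((p : ℚ_[p])⁻¹) ≠ 1 := by
  have hp0 : (p : ℚ_[p]) ≠ 0 := by exact_mod_cast (Fact.out : p.Prime).ne_zero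
  have hp1 : 1 < p := (Fact.out : p.Prime).one_lt
  intro h
  rw [chi, Complex.exp_eq_one_iff] at h
  obtain ⟨k, hk⟩ := h
  have hk' : ((fractPart ((p : ℚ_[p])⁻¹) : ℚ) : ℂ) = k := by
    have : (2 * Real.pi * Complex.I : ℂ) ≠ 0 := Complex.two_pi_I_ne_zero
    apply mul_left_cancel₀ this
    rw [hk]; ring
  have hk2 : fractPart ((p : ℚ_[p])⁻¹) = k := by exact_mod_cast hk'
  obtain ⟨a, n, h1, h2⟩ := exists_fractPart_eq_div ((p : ℚ_[p])⁻¹)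
  have h3 : (a : ℚ_[p]) / (p : ℚ_[p]) ^ n = (k : ℚ_[p]) := by
    have := congrArg (fun w : ℚ => (w : ℚ_[p])) (h1.symm.trans hk2)
    simpa using this
  rw [h3] at h2
  have h4 : ‖(p : ℚ_[p])⁻¹‖ ≤ 1 := by
    have : (p : ℚ_[p])⁻¹ = ((p : ℚ_[p])⁻¹ - k) + k := by ring
    rw [this]
    exact (IsUltrametricDist.norm_add_le_max _ _).trans (max_le h2 (Padic.norm_int_le_one k))
  rw [norm_inv, Padic.norm_p, inv_inv] at h4
  have : (1 : ℝ) < p := by exact_mod_cast hp1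
  linarith

/-- The character `χ_p` with values in the unit circle. -/
noncomputable def chiChar (p : ℕ) [Fact p.Prime] : AddChar ℚ_[p] Circle where
  toFun x := ⟨chi x, by simp [Submonoid.unitSphere, norm_chi]⟩
  map_zero_eq_one' := Circle.ext chi_zero
  map_add_eq_mul' x y := Circle.ext (chi_add x y)

lemma coe_chiChar (x : ℚ_[p]) : (chiChar p x : ℂ) = chi x := rfl

lemma continuous_chiChar : Continuous (chiChar p) :=
  continuous_induced_rng.mpr continuous_chi

/-- The value group is discrete: a coordinate with `|q_k| > p^M` has `|q_k| ≥ p^(M+1)`, so `y = p⁻¹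
q_k⁻¹ e_k` still lies in the dual ball, and `q · y = p⁻¹`. -/
lemma exists_chi_dotProduct_ne_one {q : Space p} {M : ℤ} (hq : (p : ℝ) ^ M < ‖q‖) :
    ∃ y : Space p, ‖y‖ ≤ (p : ℝ) ^ (-M) ∧ chi (q ⬝ᵥ y) ≠ 1 := by
  have hp0 : (p : ℚ_[p]) ≠ 0 := by exact_mod_cast (Fact.out : p.Prime).ne_zero
  have hp1 : (0 : ℝ) < p := by exact_mod_cast (Fact.out : p.Prime).pos
  obtain ⟨k, hk⟩ : ∃ k, (p : ℝ) ^ M < ‖q k‖ := by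
    by_contra! h
    exact absurd ((pi_norm_le_iff_of_nonneg (by positivity)).mpr h) (not_le.mpr hq)
  have hk1 : (p : ℝ) ^ (M + 1) ≤ ‖q k‖ := by
    by_contra! h
    exact absurd ((Padic.norm_le_pow_iff_norm_lt_pow_add_one _ _).mpr h) (not_le.mpr hk)
  have hqk : q k ≠ 0 := by
    intro h
    rw [h, norm_zero] at hk
    exact absurd hk (not_lt.mpr (by positivity))
  refine ⟨Pi.single k ((p : ℚ_[p])⁻¹ * (q k)⁻¹), ?_, ?_⟩
  · rw [Pi.norm_single, norm_mul, norm_inv, norm_inv, Padic.norm_p, inv_inv,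
      ← div_eq_mul_inv, div_le_iff₀ (by positivity)]
    calc (p : ℝ) = (p : ℝ) ^ (-M) * (p : ℝ) ^ (M + 1) := by
          rw [← zpow_add₀ hp1.ne']; simp
      _ ≤ _ := by gcongr
  · rw [dotProduct_single, mul_comm, mul_assoc, inv_mul_cancel₀ hqk, mul_one]
    exact chi_inv_p_ne_one

lemma norm_dotProduct_le (x y : Space p) : ‖x ⬝ᵥ y‖ ≤ ‖x‖ * ‖y‖ := by
  refine IsUltrametricDist.norm_sum_le_of_forall_le_of_nonneg (by positivity) fun i _ => ?_
  rw [norm_mul]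
  gcongr <;> exact norm_le_pi_norm _ i

lemma chi_dotProduct_eq_one {x y : Space p} {M : ℤ} (hx : ‖x‖ ≤ (p : ℝ) ^ M)
    (hy : ‖y‖ ≤ (p : ℝ) ^ (-M)) : chi (x ⬝ᵥ y) = 1 := by
  have hp1 : (0 : ℝ) < p := by exact_mod_cast (Fact.out : p.Prime).pos
  refine chi_of_norm_le_one ((norm_dotProduct_le x y).trans ?_)
  calc ‖x‖ * ‖y‖ ≤ (p : ℝ) ^ M * (p : ℝ) ^ (-M) := by gcongr
    _ = 1 := by rw [← zpow_add₀ hp1.ne']; simp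

end Character

/-! ### A vanishing criterion -/

section Vanishing

variable {p : ℕ} [Fact p.Prime]

lemma isOpen_padicBall (a : Space p) (n : ℤ) : IsOpen (Metric.closedBall a ((p : ℝ) ^ n)) :=
  IsUltrametricDist.isOpen_closedBall _
    (zpow_pos (by exact_mod_cast (Fact.out : p.Prime).pos) n).ne'

lemma exists_zpow_le {ε : ℝ} (hε : 0 < ε) : ∃ n : ℤ, n ≤ 0 ∧ (p : ℝ) ^ n ≤ ε := by
  have hp1 : (1 : ℝ) < p := by exact_mod_cast (Fact.out : p.Prime).one_lt
  obtain ⟨n, hn⟩ := exists_pow_lt_of_lt_one hε (inv_lt_one_of_one_lt₀ hp1)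
  exact ⟨-n, by simp, by simpa [zpow_neg] using hn.le⟩

lemma exists_le_zpow (R : ℝ) : ∃ n : ℤ, 0 ≤ n ∧ R ≤ (p : ℝ) ^ n := by
  have hp1 : (1 : ℝ) < p := by exact_mod_cast (Fact.out : p.Prime).one_lt
  obtain ⟨n, hn⟩ := pow_unbounded_of_one_lt R hp1
  exact ⟨n, by simp, by simpa using hn.le⟩

/-- The balls of `ℚ_p³`. -/
def padicBalls (p : ℕ) [Fact p.Prime] : Set (Set (Space p)) :=
  {s | ∃ (a : Space p) (n : ℤ), s = Metric.closedBall a ((p : ℝ) ^ n)}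

lemma borel_eq_generateFrom_padicBalls :
    (inferInstance : MeasurableSpace (Space p)) = MeasurableSpace.generateFrom (padicBalls p) := by
  have hp1 : (0 : ℝ) < p := by exact_mod_cast (Fact.out : p.Prime).pos
  rw [BorelSpace.measurable_eq (α := Space p)]
  refine (TopologicalSpace.isTopologicalBasis_of_isOpen_of_nhds ?_ ?_).borel_eq_generateFrom
  · rintro _ ⟨a, n, rfl⟩
    exact isOpen_padicBall a n
  · intro a u ha hu
    obtain ⟨ε, hε, h⟩ := Metric.isOpen_iff.mp hu a ha
    obtain ⟨n, -, hn⟩ := exists_zpow_le (p := p) (half_pos hε)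
    exact ⟨_, ⟨a, n, rfl⟩, Metric.mem_closedBall_self (by positivity),
      (Metric.closedBall_subset_ball (hn.trans_lt (half_lt_self hε))).trans h⟩

lemma isPiSystem_padicBalls : IsPiSystem (padicBalls p) := by
  rintro _ ⟨a, n, rfl⟩ _ ⟨b, k, rfl⟩ hne
  rcases IsUltrametricDist.closedBall_subset_trichotomy (x := a) (y := b) (r := (p : ℝ) ^ n)
    (s := (p : ℝ) ^ k) with h | h | h
  · rw [Set.inter_eq_left.mpr h]; exact ⟨a, n, rfl⟩
  · rw [Set.inter_eq_right.mpr h]; exact ⟨b, k, rfl⟩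
  · exact absurd h (Set.not_disjoint_iff_nonempty_inter.mpr hne)

/-- Inside a fixed large ball the measurable sets over which `f` integrates to zero form a Dynkin
class. It contains the π-system of balls, since two balls are nested or disjoint, and so it contains
every Borel set. Countably many large balls exhaust the space. -/
theorem ae_eq_zero_of_forall_setIntegral_ball {E : Type*} [NormedAddCommGroup E] [NormedSpace ℝ E]
    [CompleteSpace E] {f : Space p → E} (hf : LocallyIntegrable f (haar p))
    (h : ∀ (a : Space p) (n : ℤ), ∫ x in Metric.closedBall a ((p : ℝ) ^ n), f x ∂(haar p) = 0) :
    f =ᵐ[haar p] 0 := by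
  have hp1 : (1 : ℝ) < p := by exact_mod_cast (Fact.out : p.Prime).one_lt
  have key : ∀ N : ℕ, f =ᵐ[(haar p).restrict (Metric.closedBall 0 ((p : ℝ) ^ (N : ℤ)))] 0 := by
    intro N
    set B := Metric.closedBall (0 : Space p) ((p : ℝ) ^ (N : ℤ)) with hB
    have hfB : Integrable f ((haar p).restrict B) :=
      hf.integrableOn_isCompact (isCompact_closedBall _ _)
    refine hfB.ae_eq_zero_of_forall_setIntegral_eq_zero fun s hs _ => ?_
    have hBm : MeasurableSet B := Metric.isClosed_closedBall.measurableSet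
    -- The complement step needs the total integral over the large ball to vanish.
    have htot : ∫ x, f x ∂((haar p).restrict B) = 0 := h 0 N
    induction s, hs using MeasurableSpace.induction_on_inter
      (borel_eq_generateFrom_padicBalls (p := p)) isPiSystem_padicBalls with
    | empty => simp
    | basic t ht =>
      obtain ⟨a, n, rfl⟩ := ht
      rw [Measure.restrict_restrict Metric.isClosed_closedBall.measurableSet]
      rcases IsUltrametricDist.closedBall_subset_trichotomy (x := a) (y := 0) (r := (p : ℝ) ^ n)
        (s := (p : ℝ) ^ (N : ℤ)) with h1 | h1 | h1
      · rw [Set.inter_eq_left.mpr h1]; exact h a n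
      · rw [Set.inter_eq_right.mpr h1]; exact h 0 N
      · rw [hB, Set.disjoint_iff_inter_eq_empty.mp h1]; simp
    | compl t ht ih =>
      have := integral_add_compl ht hfB
      rw [ih (measure_lt_top_of_subset (Set.subset_univ _) (by
        simpa using (isCompact_closedBall _ _).measure_lt_top.ne)), zero_add, htot] at this
      exact this
    | iUnion g hd hg ih =>
      rw [integral_iUnion hg hd hfB.integrableOn]
      simp only [fun i => ih i (measure_lt_top_of_subset (Set.subset_univ _) (by
        simpa using (isCompact_closedBall _ _).measure_lt_top.ne)), tsum_zero]
  have hU : (⋃ N : ℕ, Metric.closedBall (0 : Space p) ((p : ℝ) ^ (N : ℤ))) = Set.univ := by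
    refine Set.eq_univ_of_forall fun x => ?_
    obtain ⟨n, hn⟩ := pow_unbounded_of_one_lt ‖x‖ hp1
    exact Set.mem_iUnion.mpr ⟨n, by simpa using hn.le⟩
  rw [← Measure.restrict_univ (μ := haar p), ← hU]
  exact (ae_restrict_iUnion_iff _ _).mpr key

end Vanishing

end PadicDirac

namespace PadicDirac

/-! ### Duality for the Fourier integral -/

section Duality

variable {p : ℕ} [Fact p.Prime]

/-- The bilinear form `(x, q) ↦ -(x · q)`. -/
noncomputable def negDot (p : ℕ) [Fact p.Prime] : Space p →ₗ[ℚ_[p]] Space p →ₗ[ℚ_[p]] ℚ_[p] :=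
  -(dotProductBilin ℚ_[p] ℚ_[p])

lemma negDot_apply (x q : Space p) : negDot p x q = -(x ⬝ᵥ q) := rfl

lemma continuous_negDot : Continuous fun x : Space p × Space p => negDot p x.1 x.2 := by
  simp only [negDot_apply, dotProduct]
  fun_prop

/-- `VectorFourier.fourierIntegral` evaluates the character at minus the pairing; the sign built
into `negDot` restores `χ_p(+q · x)`. -/
lemma fourier_eq (f : Space p → Spinor) :
    VectorFourier.fourierIntegral (chiChar p) (haar p) (negDot p) f = fourier f := by
  funext q
  simp only [VectorFourier.fourierIntegral, fourier, negDot_apply, neg_neg, Circle.smul_def,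
    coe_chiChar, dotProduct_comm q]

lemma fourier_eq_flip (f : Space p → Spinor) :
    VectorFourier.fourierIntegral (chiChar p) (haar p) (negDot p).flip f = fourier f := by
  funext q
  simp only [VectorFourier.fourierIntegral, fourier, negDot_apply, neg_neg, Circle.smul_def,
    coe_chiChar, LinearMap.flip_apply]

lemma fourier_eq_neg_flip (f : Space p → Spinor) :
    VectorFourier.fourierIntegral (chiChar p) (haar p) (-(negDot p).flip) f =
      fun x => fourier f (-x) := by
  funext q
  simp only [VectorFourier.fourierIntegral, fourier, negDot_apply, neg_neg, Circle.smul_def,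
    coe_chiChar, LinearMap.flip_apply, LinearMap.neg_apply, neg_dotProduct]

lemma continuous_fourier {f : Space p → Spinor} (hf : Integrable f (haar p)) :
    Continuous (fourier f) := by
  rw [← fourier_eq]
  exact VectorFourier.fourierIntegral_continuous continuous_chiChar continuous_negDot hf

/-- Fubini: conjugating the character reverses its sign, so the formal adjoint of the Fourier
integral is `g ↦ ĝ(-·)`. -/
lemma integral_inner_fourier {f g : Space p → Spinor} (hf : Integrable f (haar p))
    (hg : Integrable g (haar p)) :
    ∫ q, inner ℂ (fourier f q) (g q) ∂(haar p) =
      ∫ x, inner ℂ (f x) (fourier g (-x)) ∂(haar p) := by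
  have := VectorFourier.integral_sesq_fourierIntegral_eq_neg_flip (innerSL ℂ)
    continuous_chiChar continuous_negDot hf hg
  rw [fourier_eq, fourier_eq_neg_flip] at this
  exact this

lemma integral_smul_fourier {s : Space p → ℂ} {f : Space p → Spinor} (hs : Integrable s (haar p))
    (hf : Integrable f (haar p)) :
    ∫ q, s q • fourier f q ∂(haar p) =
      ∫ y, (∫ q, chi (q ⬝ᵥ y) * s q ∂(haar p)) • f y ∂(haar p) := by
  have := VectorFourier.integral_fourierIntegral_smul_eq_flip
    continuous_chiChar continuous_negDot hs hf
  rw [fourier_eq_flip] at this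
  rw [← this]
  simp only [VectorFourier.fourierIntegral, negDot_apply, neg_neg, Circle.smul_def,
    coe_chiChar, smul_eq_mul]

lemma fourier_comp_neg (f : Space p → Spinor) (q : Space p) :
    fourier (fun x => f (-x)) q = fourier f (-q) := by
  rw [fourier, ← integral_neg_eq_self, fourier]
  simp

lemma fourier_clm (A : Spinor →L[ℂ] Spinor) {f : Space p → Spinor} (hf : Integrable f (haar p)) :
    fourier (fun x => A (f x)) = fun q => A (fourier f q) := by
  funext q
  simp only [fourier, ← _root_.map_smul]
  exact ContinuousLinearMap.integral_comp_comm A (integrable_chi_smul hf q)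

end Duality

/-! ### Schwartz-Bruhat functions -/

section SchwartzBruhat

variable {p : ℕ} [Fact p.Prime]

/-- Functions supported in the ball of radius `p ^ M` and invariant under translation by the ball
of radius `p ^ (-M)`. -/
structure IsSchwartzBruhat (M : ℤ) (f : Space p → Spinor) : Prop where
  apply_add : ∀ x y, ‖y‖ ≤ (p : ℝ) ^ (-M) → f (x + y) = f x
  apply_eq_zero : ∀ x, (p : ℝ) ^ M < ‖x‖ → f x = 0

lemma one_lt_cast_prime : (1 : ℝ) < p := by exact_mod_cast (Fact.out : p.Prime).one_lt

lemma cast_prime_pos : (0 : ℝ) < p := by exact_mod_cast (Fact.out : p.Prime).pos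

/-- The volume of the ball of radius `p ^ n`. -/
noncomputable def ballVolume (p : ℕ) [Fact p.Prime] (n : ℤ) : ℝ :=
  (haar p).real (Metric.closedBall 0 ((p : ℝ) ^ n))

lemma haar_closedBall_zero_one : haar p (Metric.closedBall 0 1) = 1 :=
  Measure.addHaarMeasure_self (K₀ := unitBall p)

lemma ballVolume_zero : ballVolume p 0 = 1 := by
  simp [ballVolume, Measure.real, haar_closedBall_zero_one]

lemma haar_real_closedBall (a : Space p) (n : ℤ) :
    (haar p).real (Metric.closedBall a ((p : ℝ) ^ n)) = ballVolume p n := by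
  have : Metric.closedBall a ((p : ℝ) ^ n) =
      (fun x => -a + x) ⁻¹' Metric.closedBall 0 ((p : ℝ) ^ n) := by
    ext x
    simp [dist_eq_norm, neg_add_eq_sub]
  rw [this, Measure.real, measure_preimage_add, ballVolume, Measure.real]

lemma IsSchwartzBruhat.mono {M M' : ℤ} {f : Space p → Spinor} (hf : IsSchwartzBruhat M f)
    (h : M ≤ M') : IsSchwartzBruhat M' f where
  apply_add x y hy := hf.apply_add x y
    (hy.trans (zpow_le_zpow_right₀ one_lt_cast_prime.le (by omega)))
  apply_eq_zero x hx := hf.apply_eq_zero x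
    ((zpow_le_zpow_right₀ one_lt_cast_prime.le h).trans_lt hx)

lemma IsSchwartzBruhat.add {M : ℤ} {f g : Space p → Spinor} (hf : IsSchwartzBruhat M f)
    (hg : IsSchwartzBruhat M g) : IsSchwartzBruhat M (f + g) where
  apply_add x y hy := by simp [hf.apply_add x y hy, hg.apply_add x y hy]
  apply_eq_zero x hx := by simp [hf.apply_eq_zero x hx, hg.apply_eq_zero x hx]

lemma IsSchwartzBruhat.const_smul {M : ℤ} {f : Space p → Spinor} (hf : IsSchwartzBruhat M f)
    (c : ℂ) : IsSchwartzBruhat M (c • f) where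
  apply_add x y hy := by simp [hf.apply_add x y hy]
  apply_eq_zero x hx := by simp [hf.apply_eq_zero x hx]

lemma IsSchwartzBruhat.comp_neg {M : ℤ} {f : Space p → Spinor} (hf : IsSchwartzBruhat M f) :
    IsSchwartzBruhat M (fun x => f (-x)) where
  apply_add x y hy := by
    rw [neg_add]
    exact hf.apply_add _ _ (by rwa [norm_neg])
  apply_eq_zero x hx := hf.apply_eq_zero _ (by rwa [norm_neg])

lemma IsSchwartzBruhat.clm_comp {M : ℤ} {f : Space p → Spinor} (hf : IsSchwartzBruhat M f)
    (A : Spinor →L[ℂ] Spinor) : IsSchwartzBruhat M (fun x => A (f x)) where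
  apply_add x y hy := by rw [hf.apply_add x y hy]
  apply_eq_zero x hx := by rw [hf.apply_eq_zero x hx, _root_.map_zero]

lemma IsSchwartzBruhat.continuous {M : ℤ} {f : Space p → Spinor} (hf : IsSchwartzBruhat M f) :
    Continuous f := by
  refine IsLocallyConstant.continuous ((IsLocallyConstant.iff_eventually_eq _).mpr fun x => ?_)
  filter_upwards [Metric.closedBall_mem_nhds x (zpow_pos (cast_prime_pos (p := p)) (-M))] with y hy
  rw [← hf.apply_add x (y - x) (by simpa [dist_eq_norm] using hy), add_sub_cancel]

lemma IsSchwartzBruhat.hasCompactSupport {M : ℤ} {f : Space p → Spinor}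
    (hf : IsSchwartzBruhat M f) : HasCompactSupport f :=
  HasCompactSupport.intro (isCompact_closedBall 0 ((p : ℝ) ^ M)) fun x hx =>
    hf.apply_eq_zero x (by simpa using hx)

lemma IsSchwartzBruhat.integrable {M : ℤ} {f : Space p → Spinor} (hf : IsSchwartzBruhat M f) :
    Integrable f (haar p) :=
  hf.continuous.integrable_of_hasCompactSupport hf.hasCompactSupport

lemma IsSchwartzBruhat.memLp {M : ℤ} {f : Space p → Spinor} (hf : IsSchwartzBruhat M f) :
    MemLp f 2 (haar p) :=
  hf.continuous.memLp_of_hasCompactSupport hf.hasCompactSupport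

lemma isSchwartzBruhat_indicator (a : Space p) (n : ℤ) (v : Spinor) :
    ∃ M, IsSchwartzBruhat M ((Metric.closedBall a ((p : ℝ) ^ n)).indicator fun _ => v) := by
  obtain ⟨k, -, hk⟩ := exists_le_zpow (p := p) (max ‖a‖ ((p : ℝ) ^ n))
  refine ⟨max k (-n), fun x y hy => ?_, fun x hx => ?_⟩
  · have hy' : ‖y‖ ≤ (p : ℝ) ^ n :=
      hy.trans (zpow_le_zpow_right₀ one_lt_cast_prime.le (by omega))
    have : x + y ∈ Metric.closedBall a ((p : ℝ) ^ n) ↔ x ∈ Metric.closedBall a ((p : ℝ) ^ n) := by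
      simp only [mem_closedBall_iff_norm]
      constructor <;> intro h
      · rw [show x - a = (x + y - a) + -y by abel]
        exact (IsUltrametricDist.norm_add_le_max _ _).trans (max_le h (by rwa [norm_neg]))
      · rw [show x + y - a = (x - a) + y by abel]
        exact (IsUltrametricDist.norm_add_le_max _ _).trans (max_le h hy')
    by_cases h : x ∈ Metric.closedBall a ((p : ℝ) ^ n)
    · rw [Set.indicator_of_mem h, Set.indicator_of_mem (this.mpr h)]
    · rw [Set.indicator_of_notMem h, Set.indicator_of_notMem (mt this.mp h)]
  · refine Set.indicator_of_notMem (fun h => ?_) _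
    rw [mem_closedBall_iff_norm] at h
    have h1 : ‖x‖ ≤ max ‖a‖ ((p : ℝ) ^ n) := by
      rw [show x = (x - a) + a by abel]
      exact (IsUltrametricDist.norm_add_le_max _ _).trans
        (max_le (h.trans (le_max_right _ _)) (le_max_left _ _))
    have h2 : (p : ℝ) ^ k ≤ (p : ℝ) ^ (max k (-n)) :=
      zpow_le_zpow_right₀ one_lt_cast_prime.le (le_max_left _ _)
    linarith

/-- Compactness makes local constancy uniform: the fibres of `f` cover its support, and a Lebesgue
number of this cover is a radius of translation invariance. -/
lemma isSchwartzBruhat_of_isLocallyConstant {f : Space p → Spinor} (hf : IsLocallyConstant f)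
    (hc : HasCompactSupport f) : ∃ M, IsSchwartzBruhat M f := by
  obtain ⟨R, hR⟩ := (hc.isCompact.isBounded).exists_norm_le
  obtain ⟨δ, hδ, h⟩ := lebesgue_number_lemma_of_metric (c := fun v : Spinor => f ⁻¹' {v})
    hc.isCompact (fun v => hf.isOpen_fiber v)
    (fun x _ => Set.mem_iUnion.mpr ⟨f x, rfl⟩)
  obtain ⟨k, -, hk⟩ := exists_le_zpow (p := p) R
  obtain ⟨n, -, hn⟩ := exists_zpow_le (p := p) (half_pos hδ)
  -- One index serves both purposes: `p^M` bounds the support and `p^(-M)` stays below the Lebesgue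
  -- number.
  refine ⟨max k (-n), fun x y hy => ?_, fun x hx => ?_⟩
  · have hy' : ‖y‖ < δ := by
      refine (hy.trans (zpow_le_zpow_right₀ one_lt_cast_prime.le (?_ : _ ≤ n))).trans_lt
        (hn.trans_lt (half_lt_self hδ))
      omega
    by_cases hx : x ∈ tsupport f
    · obtain ⟨v, hv⟩ := h x hx
      have h1 : f x = v := hv (Metric.mem_ball_self hδ)
      have h2 : f (x + y) = v := hv (by simpa [dist_eq_norm] using hy')
      rw [h1, h2]
    -- The Lebesgue number controls only balls centred in the support, so here the ball is taken
    -- about `x + y`.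
    · by_cases hxy : x + y ∈ tsupport f
      · obtain ⟨v, hv⟩ := h _ hxy
        have h1 : f (x + y) = v := hv (Metric.mem_ball_self hδ)
        have h2 : f x = v := hv (by simpa [dist_eq_norm] using hy')
        rw [h1, h2]
      · rw [image_eq_zero_of_notMem_tsupport hx, image_eq_zero_of_notMem_tsupport hxy]
  · refine image_eq_zero_of_notMem_tsupport fun hmem => ?_
    have h2 : (p : ℝ) ^ k ≤ (p : ℝ) ^ (max k (-n)) :=
      zpow_le_zpow_right₀ one_lt_cast_prime.le (le_max_left _ _)
    linarith [hR x hmem]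

/-- The Fourier transform exchanges the support and the translation invariance. -/
lemma IsSchwartzBruhat.fourier {M : ℤ} {f : Space p → Spinor} (hf : IsSchwartzBruhat M f) :
    IsSchwartzBruhat M (fourier f) where
  apply_add q y hy := by
    unfold PadicDirac.fourier
    congr 1
    funext x
    by_cases hx : ‖x‖ ≤ (p : ℝ) ^ M
    · rw [add_dotProduct, chi_add, dotProduct_comm y, chi_dotProduct_eq_one hx hy, mul_one]
    · rw [hf.apply_eq_zero x (not_le.mp hx), smul_zero, smul_zero]
  apply_eq_zero q hq := by
    obtain ⟨y, hy, hne⟩ := exists_chi_dotProduct_ne_one hq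
    -- Translation by `y` leaves `f` fixed but multiplies the integral by `χ(q · y) ≠ 1`, so the
    -- integral is zero.
    have h : PadicDirac.fourier f q = chi (q ⬝ᵥ y) • PadicDirac.fourier f q := by
      conv_lhs => rw [PadicDirac.fourier, ← integral_add_right_eq_self _ y]
      rw [PadicDirac.fourier, ← integral_smul]
      congr 1
      funext x
      rw [hf.apply_add x y hy, dotProduct_add, chi_add, mul_comm, mul_smul]
    have h2 : (chi (q ⬝ᵥ y) - 1) • PadicDirac.fourier f q = 0 := by
      rw [sub_smul, ← h, one_smul, sub_self]
    exact (smul_eq_zero.mp h2).resolve_left (sub_ne_zero.mpr hne)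

/-- Orthogonality of characters on the compact group formed by the ball: `q ↦ χ(q · z)` is trivial
on it exactly when `z` lies in the dual ball, and a nontrivial character integrates to zero. -/
lemma setIntegral_chi (M : ℤ) (z : Space p) :
    ∫ q in Metric.closedBall (0 : Space p) ((p : ℝ) ^ M), chi (q ⬝ᵥ z) ∂(haar p) =
      (Metric.closedBall 0 ((p : ℝ) ^ (-M))).indicator (fun _ => (ballVolume p M : ℂ)) z := by
  by_cases hz : ‖z‖ ≤ (p : ℝ) ^ (-M)
  · rw [Set.indicator_of_mem (by simpa using hz)]
    rw [setIntegral_congr_fun (g := fun _ => (1 : ℂ)) Metric.isClosed_closedBall.measurableSet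
      (fun q hq => chi_dotProduct_eq_one (by simpa using hq) hz)]
    simp [ballVolume]
  · rw [Set.indicator_of_notMem (by simpa using hz)]
    obtain ⟨y, hy, hne⟩ := exists_chi_dotProduct_ne_one (not_le.mp hz)
    rw [neg_neg] at hy
    set B := Metric.closedBall (0 : Space p) ((p : ℝ) ^ M) with hB
    have hBm : MeasurableSet B := Metric.isClosed_closedBall.measurableSet
    have h : ∫ q in B, chi (q ⬝ᵥ z) ∂(haar p) = chi (z ⬝ᵥ y) * ∫ q in B, chi (q ⬝ᵥ z) ∂(haar p) := by
      rw [← integral_indicator hBm, ← integral_const_mul]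
      conv_lhs => rw [← integral_add_right_eq_self _ y]
      congr 1
      funext q
      have : q + y ∈ B ↔ q ∈ B := by
        simp only [hB, mem_closedBall_iff_norm, sub_zero]
        constructor <;> intro h
        · rw [show q = (q + y) + -y by abel]
          exact (IsUltrametricDist.norm_add_le_max _ _).trans (max_le h (by rwa [norm_neg]))
        · exact (IsUltrametricDist.norm_add_le_max _ _).trans (max_le h hy)
      by_cases hq : q ∈ B
      · rw [Set.indicator_of_mem hq, Set.indicator_of_mem (this.mpr hq), add_dotProduct, chi_add,
          dotProduct_comm y, mul_comm]
      · rw [Set.indicator_of_notMem hq, Set.indicator_of_notMem (mt this.mp hq), mul_zero]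
    have h2 : (chi (z ⬝ᵥ y) - 1) * ∫ q in B, chi (q ⬝ᵥ z) ∂(haar p) = 0 := by
      rw [sub_mul, ← h, one_mul, sub_self]
    exact (mul_eq_zero.mp h2).resolve_left (sub_ne_zero.mpr hne)

/-- Because `f̂` lives in the ball of radius `p^M`, the outer character may be cut off there. The
multiplication formula then turns the double transform into an integral of `f` over the ball of
radius `p^(-M)` about `x`, where `f` is constant. -/
lemma IsSchwartzBruhat.fourier_fourier_aux {M : ℤ} {f : Space p → Spinor}
    (hf : IsSchwartzBruhat M f) (x : Space p) :
    PadicDirac.fourier (PadicDirac.fourier f) (-x) =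
      ((ballVolume p M * ballVolume p (-M) : ℝ) : ℂ) • f x := by
  set B := Metric.closedBall (0 : Space p) ((p : ℝ) ^ M) with hB
  have hBm : MeasurableSet B := Metric.isClosed_closedBall.measurableSet
  have hcont : Continuous fun q : Space p => chi (-x ⬝ᵥ q) :=
    continuous_chi.comp (by fun_prop)
  have hs : Integrable (B.indicator fun q => chi (-x ⬝ᵥ q)) (haar p) :=
    (hcont.continuousOn.integrableOn_compact (isCompact_closedBall _ _)).integrable_indicator hBm
  have h1 : PadicDirac.fourier (PadicDirac.fourier f) (-x) =
      ∫ q, B.indicator (fun q => chi (-x ⬝ᵥ q)) q • PadicDirac.fourier f q ∂(haar p) := by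
    rw [PadicDirac.fourier]
    congr 1
    funext q
    by_cases hq : q ∈ B
    · rw [Set.indicator_of_mem hq]
    · rw [Set.indicator_of_notMem hq, hf.fourier.apply_eq_zero q (by simpa [hB] using hq),
        smul_zero, smul_zero]
  have h2 : ∀ y, ∫ q, chi (q ⬝ᵥ y) * B.indicator (fun q => chi (-x ⬝ᵥ q)) q ∂(haar p) =
      (Metric.closedBall 0 ((p : ℝ) ^ (-M))).indicator (fun _ => (ballVolume p M : ℂ)) (y - x) := by
    intro y
    rw [← setIntegral_chi, ← integral_indicator hBm]
    congr 1
    funext q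
    by_cases hq : q ∈ B
    · rw [Set.indicator_of_mem hq, Set.indicator_of_mem hq, ← chi_add, dotProduct_comm (-x),
        ← dotProduct_add, sub_eq_add_neg]
    · rw [Set.indicator_of_notMem hq, Set.indicator_of_notMem hq, mul_zero]
  rw [h1, integral_smul_fourier hs hf.integrable]
  simp only [h2]
  have h3 : ∀ y, (Metric.closedBall 0 ((p : ℝ) ^ (-M))).indicator
      (fun _ => (ballVolume p M : ℂ)) (y - x) • f y =
      (Metric.closedBall x ((p : ℝ) ^ (-M))).indicator (fun _ => (ballVolume p M : ℂ) • f x) y := by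
    intro y
    by_cases hy : ‖y - x‖ ≤ (p : ℝ) ^ (-M)
    · rw [Set.indicator_of_mem (by simpa using hy),
        Set.indicator_of_mem (by simpa [dist_eq_norm] using hy), ← hf.apply_add x (y - x) hy,
        add_sub_cancel]
    · rw [Set.indicator_of_notMem (by simpa using hy),
        Set.indicator_of_notMem (by simpa [dist_eq_norm] using hy), zero_smul]
  simp only [h3]
  rw [integral_indicator Metric.isClosed_closedBall.measurableSet, setIntegral_const,
    haar_real_closedBall, ← Complex.coe_smul, smul_smul]
  push_cast
  rw [mul_comm]

/-- The double transform of the unit-ball indicator does not depend on the index used to describe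
it, so the constant for `M ≥ 0` equals the constant for `0`, which is `1`. -/
lemma ballVolume_mul_ballVolume_neg (M : ℤ) : ballVolume p M * ballVolume p (-M) = 1 := by
  wlog hM : 0 ≤ M generalizing M
  · have := this (-M) (by omega)
    rwa [neg_neg, mul_comm] at this
  set v : Spinor := EuclideanSpace.single 0 1 with hv
  set f := (Metric.closedBall (0 : Space p) 1).indicator fun _ => v with hf
  have h0 : IsSchwartzBruhat 0 f := by
    refine ⟨fun x y hy => ?_, fun x hx => ?_⟩
    · have hy' : ‖y‖ ≤ 1 := by simpa using hy
      have : x + y ∈ Metric.closedBall (0 : Space p) 1 ↔ x ∈ Metric.closedBall (0 : Space p) 1 := by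
        simp only [mem_closedBall_iff_norm, sub_zero]
        constructor <;> intro h
        · rw [show x = (x + y) + -y by abel]
          exact (IsUltrametricDist.norm_add_le_max _ _).trans (max_le h (by rwa [norm_neg]))
        · exact (IsUltrametricDist.norm_add_le_max _ _).trans (max_le h hy')
      by_cases h : x ∈ Metric.closedBall (0 : Space p) 1
      · rw [hf, Set.indicator_of_mem h, Set.indicator_of_mem (this.mpr h)]
      · rw [hf, Set.indicator_of_notMem h, Set.indicator_of_notMem (mt this.mp h)]
    · exact Set.indicator_of_notMem (by simpa using hx) _
  have h1 := h0.fourier_fourier_aux 0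
  rw [(h0.mono hM).fourier_fourier_aux 0] at h1
  have hf0 : f 0 = v := Set.indicator_of_mem (by simp) _
  have hv0 : v ≠ 0 := by simp [hv]
  rw [hf0] at h1
  have h2 := smul_left_injective ℂ hv0 h1
  simpa [ballVolume_zero] using (Complex.ofReal_injective h2)

/-- Fourier inversion for Schwartz-Bruhat functions. -/
theorem IsSchwartzBruhat.fourier_fourier {M : ℤ} {f : Space p → Spinor}
    (hf : IsSchwartzBruhat M f) (x : Space p) :
    PadicDirac.fourier (PadicDirac.fourier f) (-x) = f x := by
  rw [hf.fourier_fourier_aux, ballVolume_mul_ballVolume_neg, Complex.ofReal_one, one_smul]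

end SchwartzBruhat

end PadicDirac

namespace PadicDirac

/-! ### The Fourier transform on `L²` -/

section FourierL2

variable {p : ℕ} [Fact p.Prime]

lemma inner_toLp_toLp {f g : Space p → Spinor} (hf : MemLp f 2 (haar p))
    (hg : MemLp g 2 (haar p)) :
    inner ℂ (hf.toLp f) (hg.toLp g) = ∫ x, inner ℂ (f x) (g x) ∂(haar p) := by
  rw [L2.inner_def]
  refine integral_congr_ae ?_
  filter_upwards [hf.coeFn_toLp, hg.coeFn_toLp] with x h1 h2
  rw [h1, h2]

lemma norm_toLp_eq_of_integral_inner_eq {f g : Space p → Spinor} (hf : MemLp f 2 (haar p))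
    (hg : MemLp g 2 (haar p))
    (h : ∫ x, inner ℂ (f x) (f x) ∂(haar p) = ∫ x, inner ℂ (g x) (g x) ∂(haar p)) :
    ‖hf.toLp f‖ = ‖hg.toLp g‖ := by
  rw [← inner_toLp_toLp hf hf, ← inner_toLp_toLp hg hg, inner_self_eq_norm_sq_to_K,
    inner_self_eq_norm_sq_to_K] at h
  have h' : ‖hf.toLp f‖ ^ 2 = ‖hg.toLp g‖ ^ 2 := by exact_mod_cast h
  exact (sq_eq_sq₀ (norm_nonneg _) (norm_nonneg _)).mp h'

/-- Plancherel: move one transform across the inner product, then apply inversion. -/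
lemma IsSchwartzBruhat.norm_toLp_fourier {M : ℤ} {f : Space p → Spinor}
    (hf : IsSchwartzBruhat M f) : ‖hf.fourier.memLp.toLp _‖ = ‖hf.memLp.toLp _‖ := by
  refine norm_toLp_eq_of_integral_inner_eq _ _ ?_
  rw [integral_inner_fourier hf.integrable hf.fourier.integrable]
  simp only [hf.fourier_fourier]

lemma IsSchwartzBruhat.norm_toLp_comp_neg {M : ℤ} {f : Space p → Spinor}
    (hf : IsSchwartzBruhat M f) : ‖hf.comp_neg.memLp.toLp _‖ = ‖hf.memLp.toLp _‖ := by
  refine norm_toLp_eq_of_integral_inner_eq _ _ ?_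
  exact integral_neg_eq_self (fun x => inner ℂ (f x) (f x)) (haar p)

/-- The classes of Schwartz-Bruhat functions. -/
noncomputable def schwartzBruhat (p : ℕ) [Fact p.Prime] : Submodule ℂ (StateSpace p) where
  carrier := {f | ∃ (M : ℤ) (g : Space p → Spinor), IsSchwartzBruhat M g ∧ f =ᵐ[haar p] g}
  add_mem' := by
    rintro f g ⟨M, f', hf, hf'⟩ ⟨N, g', hg, hg'⟩
    exact ⟨max M N, f' + g', (hf.mono (le_max_left _ _)).add (hg.mono (le_max_right _ _)),
      (Lp.coeFn_add f g).trans (hf'.add hg')⟩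
  zero_mem' := ⟨0, 0, ⟨fun _ _ _ => rfl, fun _ _ => rfl⟩, Lp.coeFn_zero _ _ _⟩
  smul_mem' := by
    rintro c f ⟨M, f', hf, hf'⟩
    exact ⟨M, c • f', hf.const_smul c, (Lp.coeFn_smul c f).trans (hf'.const_smul c)⟩

lemma IsSchwartzBruhat.toLp_mem {M : ℤ} {f : Space p → Spinor} (hf : IsSchwartzBruhat M f) :
    hf.memLp.toLp f ∈ schwartzBruhat p :=
  ⟨M, f, hf, hf.memLp.coeFn_toLp⟩

lemma exists_toLp_of_mem_schwartzBruhat {f : StateSpace p} (hf : f ∈ schwartzBruhat p) :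
    ∃ (M : ℤ) (g : Space p → Spinor) (hg : IsSchwartzBruhat M g), f = hg.memLp.toLp g := by
  obtain ⟨M, g, hg, h⟩ := hf
  exact ⟨M, g, hg, Lp.ext (h.trans hg.memLp.coeFn_toLp.symm)⟩

/-- A locally integrable function orthogonal to all Schwartz-Bruhat functions vanishes. -/
lemma ae_eq_zero_of_forall_integral_inner {f : Space p → Spinor}
    (hf : LocallyIntegrable f (haar p))
    (h : ∀ (M : ℤ) (g : Space p → Spinor), IsSchwartzBruhat M g →
      ∫ x, inner ℂ (g x) (f x) ∂(haar p) = 0) : f =ᵐ[haar p] 0 := by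
  refine ae_eq_zero_of_forall_setIntegral_ball hf fun a n => ?_
  refine ext_inner_left ℂ fun v => ?_
  have hm : MeasurableSet (Metric.closedBall a ((p : ℝ) ^ n)) :=
    Metric.isClosed_closedBall.measurableSet
  obtain ⟨M, hM⟩ := isSchwartzBruhat_indicator a n v
  have hi : Integrable f ((haar p).restrict (Metric.closedBall a ((p : ℝ) ^ n))) :=
    hf.integrableOn_isCompact (isCompact_closedBall _ _)
  rw [inner_zero_right, ← integral_inner hi, ← h M _ hM, ← integral_indicator hm]
  congr 1
  funext x
  by_cases hx : x ∈ Metric.closedBall a ((p : ℝ) ^ n)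
  · rw [Set.indicator_of_mem hx, Set.indicator_of_mem hx]
  · rw [Set.indicator_of_notMem hx, Set.indicator_of_notMem hx, inner_zero_left]

lemma dense_schwartzBruhat : Dense (schwartzBruhat p : Set (StateSpace p)) := by
  rw [Submodule.dense_iff_topologicalClosure_eq_top, Submodule.topologicalClosure_eq_top_iff,
    Submodule.eq_bot_iff]
  intro f hf
  rw [Submodule.mem_orthogonal] at hf
  refine Lp.ext ((ae_eq_zero_of_forall_integral_inner ?_ ?_).trans (Lp.coeFn_zero _ _ _).symm)
  · exact (Lp.memLp f).locallyIntegrable (by norm_num)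
  · intro M g hg
    rw [← hf _ hg.toLp_mem, L2.inner_def]
    refine integral_congr_ae ?_
    filter_upwards [hg.memLp.coeFn_toLp] with x hx
    rw [hx]

lemma IsSchwartzBruhat.mem_integrableStates {M : ℤ} {f : Space p → Spinor}
    (hf : IsSchwartzBruhat M f) : hf.memLp.toLp f ∈ integrableStates p :=
  ⟨hf.integrable.congr hf.memLp.coeFn_toLp.symm, by
    rw [fourier_congr hf.memLp.coeFn_toLp]
    exact hf.fourier.memLp⟩

lemma denseRange_subtype_integrableStates : DenseRange (integrableStates p).subtype := by
  refine dense_schwartzBruhat.mono fun f hf => ?_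
  obtain ⟨M, g, hg, rfl⟩ := exists_toLp_of_mem_schwartzBruhat hf
  exact ⟨⟨_, hg.mem_integrableStates⟩, rfl⟩

/-- Inversion is known only for Schwartz-Bruhat functions, so the bound comes by duality: against
such a `g` the transform moves onto `g`, whose norm it preserves. Density gives all `g`, in
particular the transform of `f` itself. -/
lemma norm_fourierIntegrable_le (f : integrableStates p) :
    ‖fourierIntegrable p f‖ ≤ ‖(f : StateSpace p)‖ := by
  have key : ∀ g : StateSpace p, ‖inner ℂ (fourierIntegrable p f) g‖ ≤ ‖(f : StateSpace p)‖ * ‖g‖ := by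
    refine fun g => dense_schwartzBruhat.induction (P := fun g : StateSpace p =>
      ‖inner ℂ (fourierIntegrable p f) g‖ ≤ ‖(f : StateSpace p)‖ * ‖g‖) ?_ ?_ g
    · intro g hgm
      obtain ⟨M, g, hg, rfl⟩ := exists_toLp_of_mem_schwartzBruhat hgm
      have h1 : inner ℂ (fourierIntegrable p f) (hg.memLp.toLp g) =
          inner ℂ (f : StateSpace p) (hg.fourier.comp_neg.memLp.toLp _) := by
        rw [← Lp.toLp_coeFn (f : StateSpace p) (Lp.memLp _), inner_toLp_toLp]
        rw [show fourierIntegrable p f = MemLp.toLp _ f.2.2 from rfl, inner_toLp_toLp,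
          integral_inner_fourier f.2.1 hg.integrable]
      rw [h1, ← hg.norm_toLp_fourier, ← hg.fourier.norm_toLp_comp_neg]
      exact norm_inner_le_norm _ _
    · exact isClosed_le (by fun_prop) (by fun_prop)
  have h := key (fourierIntegrable p f)
  rw [inner_self_eq_norm_sq_to_K] at h
  rcases (norm_nonneg (fourierIntegrable p f)).eq_or_lt with h0 | h0
  · rw [← h0]; exact norm_nonneg _
  · have h2 : ‖fourierIntegrable p f‖ * ‖fourierIntegrable p f‖ ≤
        ‖(f : StateSpace p)‖ * ‖fourierIntegrable p f‖ := by
      simpa [pow_two] using h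
    exact le_of_mul_le_mul_right h2 h0

lemma fourierL2_coe (f : integrableStates p) :
    fourierL2 p (f : StateSpace p) = fourierIntegrable p f :=
  LinearMap.extendOfNorm_eq denseRange_subtype_integrableStates
    ⟨1, fun f => by simpa using norm_fourierIntegrable_le f⟩ f

lemma IsSchwartzBruhat.fourierL2_toLp {M : ℤ} {f : Space p → Spinor}
    (hf : IsSchwartzBruhat M f) : fourierL2 p (hf.memLp.toLp f) = hf.fourier.memLp.toLp _ := by
  rw [fourierL2_coe ⟨_, hf.mem_integrableStates⟩]
  exact MemLp.toLp_congr (hf.mem_integrableStates).2 _ (Eventually.of_forall fun q =>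
    congrFun (fourier_congr hf.memLp.coeFn_toLp) q)

lemma norm_fourierL2 (f : StateSpace p) : ‖fourierL2 p f‖ = ‖f‖ := by
  refine dense_schwartzBruhat.induction (P := fun f : StateSpace p => ‖fourierL2 p f‖ = ‖f‖)
    ?_ ?_ f
  · intro g hgm
    obtain ⟨M, g, hg, rfl⟩ := exists_toLp_of_mem_schwartzBruhat hgm
    rw [hg.fourierL2_toLp, hg.norm_toLp_fourier]
  · exact isClosed_eq (by fun_prop) (by fun_prop)

/-- The range of an isometry of a complete space is closed, and by inversion it contains each
Schwartz-Bruhat `g` as the transform of `x ↦ ĝ(-x)`. -/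
lemma fourierL2_surjective : Function.Surjective (fourierL2 p) := by
  have hiso : Isometry (fourierL2 p) := AddMonoidHomClass.isometry_of_norm _ norm_fourierL2
  have hcl : IsClosed (Set.range (fourierL2 p)) := hiso.isClosedEmbedding.isClosed_range
  rw [← Set.range_eq_univ, ← hcl.closure_eq]
  refine (dense_schwartzBruhat.mono fun f hf => ?_).closure_eq
  obtain ⟨M, g, hg, rfl⟩ := exists_toLp_of_mem_schwartzBruhat hf
  refine ⟨hg.fourier.comp_neg.memLp.toLp _, ?_⟩
  rw [hg.fourier.comp_neg.fourierL2_toLp]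
  refine MemLp.toLp_congr _ _ (Eventually.of_forall fun q => ?_)
  rw [fourier_comp_neg, hg.fourier_fourier]

/-- The Fourier transform as a unitary operator. -/
noncomputable def fourierEquiv (p : ℕ) [Fact p.Prime] : StateSpace p ≃ₗᵢ[ℂ] StateSpace p :=
  LinearIsometryEquiv.ofSurjective ⟨(fourierL2 p).toLinearMap, norm_fourierL2⟩ fourierL2_surjective

lemma fourierEquiv_apply (f : StateSpace p) : fourierEquiv p f = fourierL2 p f := rfl

lemma fourierL2Inv_apply (f : StateSpace p) : fourierL2Inv p f = (fourierEquiv p).symm f := by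
  have : fourierL2 p = ((fourierEquiv p).toContinuousLinearEquiv : StateSpace p →L[ℂ] StateSpace p) :=
    rfl
  rw [fourierL2Inv, this, ContinuousLinearMap.inverse_equiv]
  rfl

/-- On integrable elements, the inverse Fourier transform is given by the conjugate integral. -/
lemma fourierEquiv_symm_toLp {g : Space p → Spinor} (hg : MemLp g 2 (haar p))
    (hg' : Integrable g (haar p)) :
    (fourierEquiv p).symm (hg.toLp g) =ᵐ[haar p] fun x => fourier g (-x) := by
  set G := (fourierEquiv p).symm (hg.toLp g) with hG
  have hc : Continuous fun x => fourier g (-x) := (continuous_fourier hg').comp continuous_neg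
  have hGl : LocallyIntegrable G (haar p) := (Lp.memLp G).locallyIntegrable (by norm_num)
  -- Two locally integrable functions are compared by pairing with Schwartz-Bruhat `f`: unitarity
  -- handles `G`, the adjoint formula handles the integral, and both give `⟨f̂, g⟩`.
  have h : (⇑G - fun x => fourier g (-x)) =ᵐ[haar p] 0 := by
    refine ae_eq_zero_of_forall_integral_inner (hGl.sub hc.locallyIntegrable) fun M f hf => ?_
    have h1 : ∫ x, inner ℂ (f x) (G x) ∂(haar p) = ∫ x, inner ℂ (f x) (fourier g (-x)) ∂(haar p) := by
      rw [← integral_inner_fourier hf.integrable hg',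
        ← inner_toLp_toLp hf.fourier.memLp hg, ← hf.fourierL2_toLp, ← fourierEquiv_apply,
        LinearIsometryEquiv.inner_map_eq_flip, ← hG, L2.inner_def]
      refine integral_congr_ae ?_
      filter_upwards [hf.memLp.coeFn_toLp] with x hx
      rw [hx]
    have hint : ∀ k : Space p → Spinor, LocallyIntegrable k (haar p) →
        Integrable (fun x => inner ℂ (f x) (k x)) (haar p) := by
      intro k hk
      have hK : IsCompact (tsupport f) := hf.hasCompactSupport
      have hb : ∃ C, ∀ x, ‖f x‖ ≤ C :=
        hf.continuous.bounded_above_of_compact_support hf.hasCompactSupport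
      obtain ⟨C, hC⟩ := hb
      have h3 : IntegrableOn (fun x => inner ℂ (f x) (k x)) (tsupport f) (haar p) := by
        have hki := hk.integrableOn_isCompact hK
        refine (hki.norm.const_mul C).mono'
          (hf.continuous.aestronglyMeasurable.inner hki.aestronglyMeasurable) ?_
        refine Eventually.of_forall fun x => (norm_inner_le_norm _ _).trans ?_
        gcongr
        exact hC x
      refine (integrableOn_iff_integrable_of_support_subset fun x hx => ?_).mp h3
      by_contra hx'
      exact hx (by simp [image_eq_zero_of_notMem_tsupport hx'])
    simp only [Pi.sub_apply, inner_sub_right]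
    rw [integral_sub (hint _ hGl) (hint _ hc.locallyIntegrable), h1, sub_self]
  filter_upwards [h] with x hx
  exact sub_eq_zero.mp hx

lemma constOp_toLp (A : Matrix (Fin 4) (Fin 4) ℂ) {f : Space p → Spinor} (hf : MemLp f 2 (haar p)) :
    constOp p A (hf.toLp f) = ((matOp A).comp_memLp' hf).toLp _ := by
  refine Lp.ext ?_
  refine ((matOp A).coeFn_compLpL _).trans (EventuallyEq.trans ?_ (MemLp.coeFn_toLp _).symm)
  filter_upwards [hf.coeFn_toLp] with x hx
  rw [hx]
  rfl

lemma constOp_fourierL2 (A : Matrix (Fin 4) (Fin 4) ℂ) (f : StateSpace p) :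
    fourierL2 p (constOp p A f) = constOp p A (fourierL2 p f) := by
  refine dense_schwartzBruhat.induction (P := fun f : StateSpace p =>
    fourierL2 p (constOp p A f) = constOp p A (fourierL2 p f)) ?_ ?_ f
  · intro g hgm
    obtain ⟨M, g, hg, rfl⟩ := exists_toLp_of_mem_schwartzBruhat hgm
    rw [hg.fourierL2_toLp, constOp_toLp, constOp_toLp]
    refine ((hg.clm_comp (matOp A)).fourierL2_toLp).trans ?_
    exact MemLp.toLp_congr _ _ (Eventually.of_forall fun q =>
      congrFun (fourier_clm (matOp A) hg.integrable) q)
  · exact isClosed_eq (by fun_prop) (by fun_prop)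

end FourierL2

end PadicDirac

namespace PadicDirac

/-! ### One-parameter unitary groups -/

section UnitaryGroup

variable {H : Type*} [NormedAddCommGroup H] [InnerProductSpace ℂ H]

lemma IsUnitaryGroupOf.map_zero {A : H →ₗ.[ℂ] H} {U : ℝ → H ≃ₗᵢ[ℂ] H} (hU : IsUnitaryGroupOf A U)
    (φ : H) : U 0 φ = φ := by
  apply (U 0).injective
  rw [← hU.map_add, add_zero]

lemma IsUnitaryGroupOf.hasDerivAt {A : H →ₗ.[ℂ] H} {U : ℝ → H ≃ₗᵢ[ℂ] H}
    (hU : IsUnitaryGroupOf A U) {φ η : H} (h : (φ, η) ∈ A.graph) (t : ℝ) :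
    HasDerivAt (fun s => U s φ) (-Complex.I • U t η) t := by
  have h0 := (hU.generator φ η).mp h
  have h1 : HasDerivAt (fun s => U t (U s φ)) (U t (-Complex.I • η)) 0 :=
    ((U t).toContinuousLinearEquiv : H →L[ℂ] H).restrictScalars ℝ |>.hasFDerivAt.comp_hasDerivAt
      (0 : ℝ) h0
  rw [_root_.map_smul] at h1
  have h2 : HasDerivAt (fun s => U t (U (s - t) φ)) (-Complex.I • U t η) t := by
    have := HasDerivAt.scomp_of_eq t h1 ((hasDerivAt_id t).sub_const t) (by simp)
    simpa [Function.comp_def] using this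
  simpa only [← hU.map_add, add_sub_cancel] using h2

lemma IsUnitaryGroupOf.mem_graph {A : H →ₗ.[ℂ] H} {U : ℝ → H ≃ₗᵢ[ℂ] H}
    (hU : IsUnitaryGroupOf A U) {φ η : H} (h : (φ, η) ∈ A.graph) (t : ℝ) :
    (U t φ, U t η) ∈ A.graph := by
  refine (hU.generator _ _).mpr ?_
  have h1 := hU.hasDerivAt h t
  have h2 : HasDerivAt (fun s => U (s + t) φ) (-Complex.I • U t η) 0 := by
    have := HasDerivAt.scomp_of_eq (0 : ℝ) h1 ((hasDerivAt_id (0 : ℝ)).add_const t) (by simp)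
    simpa [Function.comp_def] using this
  simpa only [hU.map_add] using h2

/-- The norm along the orbit is constant, and the derivative of its square at `0` is twice this real
part. This weak symmetry is all that uniqueness needs from the generator. -/
lemma IsUnitaryGroupOf.re_inner_eq_zero {A : H →ₗ.[ℂ] H} {U : ℝ → H ≃ₗᵢ[ℂ] H}
    (hU : IsUnitaryGroupOf A U) {φ η : H} (h : (φ, η) ∈ A.graph) :
    (inner ℂ φ (-Complex.I • η)).re = 0 := by
  have h0 := (hU.generator φ η).mp h
  let : InnerProductSpace ℝ H := InnerProductSpace.rclikeToReal ℂ H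
  have h1 := h0.norm_sq
  have h2 : (fun t => ‖U t φ‖ ^ 2) = fun _ => ‖φ‖ ^ 2 := by
    funext t
    rw [LinearIsometryEquiv.norm_map]
  rw [h2, hU.map_zero] at h1
  have h3 := h1.unique (hasDerivAt_const _ _)
  have h4 : inner ℝ φ (-Complex.I • η) = (inner ℂ φ (-Complex.I • η)).re := rfl
  rw [← h4]
  linarith

/-- An operator with dense domain generates at most one unitary group. -/
theorem IsUnitaryGroupOf.unique {A : H →ₗ.[ℂ] H} (hA : Dense (A.domain : Set H))
    {U V : ℝ → H ≃ₗᵢ[ℂ] H} (hU : IsUnitaryGroupOf A U) (hV : IsUnitaryGroupOf A V) : U = V := by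
  funext t
  ext φ
  refine hA.induction (P := fun φ => U t φ = V t φ) ?_ (isClosed_eq (U t).continuous
    (V t).continuous) φ
  intro φ hφ
  have hg : (φ, A ⟨φ, hφ⟩) ∈ A.graph := A.mem_graph ⟨φ, hφ⟩
  let : InnerProductSpace ℝ H := InnerProductSpace.rclikeToReal ℂ H
  set η := A ⟨φ, hφ⟩
  have hw : ∀ s, HasDerivAt (fun s => U s φ - V s φ) (-Complex.I • (U s η - V s η)) s := by
    intro s
    rw [smul_sub]
    exact (hU.hasDerivAt hg s).sub (hV.hasDerivAt hg s)
  -- Both groups preserve the graph, so the difference `w` solves `w' = -iAw`. Its norm is therefore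
  -- conserved, and `w` vanishes at time `0`.
  have hd : ∀ s, HasDerivAt (fun s => ‖U s φ - V s φ‖ ^ 2) 0 s := by
    intro s
    have h1 := (hw s).norm_sq
    have h2 : (U s φ - V s φ, U s η - V s η) ∈ A.graph :=
      A.graph.sub_mem (hU.mem_graph hg s) (hV.mem_graph hg s)
    have h3 : inner ℝ (U s φ - V s φ) (-Complex.I • (U s η - V s η)) = 0 := hU.re_inner_eq_zero h2
    rwa [h3, mul_zero] at h1
  have hc := is_const_of_deriv_eq_zero (fun s => (hd s).differentiableAt) (fun s => (hd s).deriv) t 0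
  simp only [hU.map_zero, hV.map_zero, sub_self, norm_zero] at hc
  have : ‖U t φ - V t φ‖ = 0 := by simpa using hc
  exact sub_eq_zero.mp (norm_eq_zero.mp this)

lemma expNegI_eq {A : H →ₗ.[ℂ] H} (hA : Dense (A.domain : Set H)) {U : ℝ → H ≃ₗᵢ[ℂ] H}
    (hU : IsUnitaryGroupOf A U) : expNegI A = U := by
  have h : ∃ U, IsUnitaryGroupOf A U := ⟨U, hU⟩
  rw [expNegI, dif_pos h]
  exact h.choose_spec.unique hA hU

lemma IsUnitaryGroupOf.conj {H' : Type*} [NormedAddCommGroup H'] [InnerProductSpace ℂ H']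
    {A : H →ₗ.[ℂ] H} {U : ℝ → H ≃ₗᵢ[ℂ] H} (hU : IsUnitaryGroupOf A U) (e : H' ≃ₗᵢ[ℂ] H)
    {B : H' →ₗ.[ℂ] H'} (hB : ∀ φ η, (φ, η) ∈ B.graph ↔ (e φ, e η) ∈ A.graph) :
    IsUnitaryGroupOf B fun t => (e.trans (U t)).trans e.symm where
  map_add s t φ := by simp [hU.map_add]
  continuous φ := e.symm.continuous.comp (hU.continuous (e φ))
  generator φ η := by
    rw [hB, hU.generator]
    constructor
    · intro h
      have := ((e.symm.toContinuousLinearEquiv : H →L[ℂ] H').restrictScalars ℝ).hasFDerivAt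
        |>.comp_hasDerivAt (0 : ℝ) h
      simpa [Function.comp_def] using this
    · intro h
      have := ((e.toContinuousLinearEquiv : H' →L[ℂ] H).restrictScalars ℝ).hasFDerivAt
        |>.comp_hasDerivAt (0 : ℝ) h
      simpa [Function.comp_def] using this

lemma hasDerivAt_zero_iff_tendsto {f : ℝ → H} {f' : H} : HasDerivAt f f' 0 ↔
    Tendsto (fun t : ℝ => ((t⁻¹ : ℝ) : ℂ) • (f t - f 0)) (𝓝[≠] 0) (𝓝 f') := by
  rw [hasDerivAt_iff_tendsto_slope]
  refine tendsto_congr fun t => ?_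
  simp only [slope, sub_zero, vsub_eq_sub, Complex.coe_smul]

end UnitaryGroup

/-! ### Exponentials of self-adjoint operators -/

section Exponential

variable {E : Type*} [NormedAddCommGroup E] [InnerProductSpace ℂ E] [CompleteSpace E]

/-- The operator `e^{-itA}` for a bounded operator `A`. -/
noncomputable def expOp (A : E →L[ℂ] E) (t : ℝ) : E →L[ℂ] E :=
  NormedSpace.exp ((t : ℂ) • (-Complex.I • A))

lemma expOp_zero (A : E →L[ℂ] E) : expOp A 0 = 1 := by simp [expOp]

lemma expOp_add (A : E →L[ℂ] E) (s t : ℝ) : expOp A (s + t) = expOp A s * expOp A t := by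
  let _ : NormedAlgebra ℚ (E →L[ℂ] E) := .restrictScalars ℚ ℂ (E →L[ℂ] E)
  rw [expOp, expOp, expOp, Complex.ofReal_add, add_smul]
  exact NormedSpace.exp_add_of_commute ((Commute.refl _).smul_left _ |>.smul_right _)

lemma norm_expOp_apply {A : E →L[ℂ] E} (hA : IsSelfAdjoint A) (t : ℝ) (v : E) :
    ‖expOp A t v‖ = ‖v‖ := by
  let _ : NormedAlgebra ℚ (E →L[ℂ] E) := .restrictScalars ℚ ℂ (E →L[ℂ] E)
  refine ContinuousLinearMap.norm_map_of_mem_unitary ?_ v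
  refine NormedSpace.exp_mem_unitary_of_mem_skewAdjoint ?_
  rw [skewAdjoint.mem_iff, star_smul, star_smul, hA.star_eq]
  simp

lemma hasDerivAt_expOp_apply (A : E →L[ℂ] E) (t : ℝ) (v : E) :
    HasDerivAt (fun s => expOp A s v) (expOp A t (-Complex.I • A v)) t := by
  have h1 : HasDerivAt (fun s : ℝ => expOp A s) (expOp A t * (-Complex.I • A)) t := by
    have h := hasDerivAt_exp_smul_const (𝕂 := ℂ) (-Complex.I • A) (t : ℂ)
    have := h.scomp t Complex.ofRealCLM.hasDerivAt
    simpa [Function.comp_def, expOp] using this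
  have h2 := ((ContinuousLinearMap.apply ℂ E v).restrictScalars ℝ).hasFDerivAt.comp_hasDerivAt t h1
  simpa [Function.comp_def] using h2

/-- The derivative has constant norm `‖A v‖`, so the mean value inequality applies. The estimate is
uniform in `t` and supplies the majorant for difference quotients. -/
lemma norm_expOp_apply_sub_le {A : E →L[ℂ] E} (hA : IsSelfAdjoint A) (t : ℝ) (v : E) :
    ‖expOp A t v - v‖ ≤ ‖A v‖ * |t| := by
  have := convex_univ.norm_image_sub_le_of_norm_hasDerivWithin_le (f := fun s => expOp A s v)
    (f' := fun s => expOp A s (-Complex.I • A v)) (C := ‖A v‖) (s := Set.univ) (x := (0 : ℝ))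
    (y := t) (fun s _ => (hasDerivAt_expOp_apply A s v).hasDerivWithinAt) (fun s _ => by
      rw [norm_expOp_apply hA, norm_smul]; simp) (Set.mem_univ _) (Set.mem_univ _)
  simpa [expOp_zero] using this

lemma continuous_expOp : Continuous fun x : (E →L[ℂ] E) × ℝ => expOp x.1 x.2 := by
  let _ : NormedAlgebra ℚ (E →L[ℂ] E) := .restrictScalars ℚ ℂ (E →L[ℂ] E)
  unfold expOp
  exact NormedSpace.exp_continuous.comp (by fun_prop)

/-- The function `e^{iμs} e^{-isA} v` has zero derivative and equals `v` at `s = 0`. -/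
lemma expOp_apply_of_eigenvector {A : E →L[ℂ] E} {v : E} {μ : ℝ} (h : A v = (μ : ℂ) • v) (t : ℝ) :
    expOp A t v = Complex.exp (-Complex.I * μ * t) • v := by
  have hd : ∀ s : ℝ, HasDerivAt (fun s : ℝ => Complex.exp (Complex.I * μ * s) • expOp A s v) 0 s := by
    intro s
    have h1 : HasDerivAt (fun s : ℝ => Complex.exp (Complex.I * μ * s))
        (Complex.exp (Complex.I * μ * s) * (Complex.I * μ)) s := by
      have := ((hasDerivAt_id (s : ℂ)).const_mul (Complex.I * μ)).cexp.comp_ofReal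
      simpa using this
    refine (h1.smul (hasDerivAt_expOp_apply A s v)).congr_deriv ?_
    rw [h, _root_.map_smul, _root_.map_smul, smul_smul, smul_smul, ← add_smul]
    simp only [neg_mul, mul_neg, mul_assoc, neg_add_cancel, zero_smul]
  have hc := is_const_of_deriv_eq_zero (fun s => (hd s).differentiableAt) (fun s => (hd s).deriv) t 0
  simp only [expOp_zero, Complex.ofReal_zero, mul_zero, Complex.exp_zero, one_smul,
    one_apply_eq_self] at hc
  conv_rhs => rw [← hc, smul_smul, ← Complex.exp_add]
  have : -Complex.I * μ * t + Complex.I * μ * t = 0 := by ring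
  rw [this, Complex.exp_zero, one_smul]

end Exponential

end PadicDirac

namespace PadicDirac

/-! ### Multiplication operators on `L²` -/

section Multiplication

variable {p : ℕ} [Fact p.Prime]

lemma mem_graph_mulOp {M : Space p → Spinor →L[ℂ] Spinor} {f g : StateSpace p} :
    (f, g) ∈ (mulOp M).graph ↔ (fun q => M q (f q)) =ᵐ[haar p] g := by
  rw [LinearPMap.mem_graph_iff]
  constructor
  · rintro ⟨⟨f', hf'⟩, rfl, h⟩
    have h' : MemLp.toLp _ hf' = g := h
    rw [← h']
    exact (MemLp.coeFn_toLp hf').symm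
  · intro h
    have hf : MemLp (fun q => M q (f q)) 2 (haar p) := (memLp_congr_ae h).mpr (Lp.memLp g)
    exact ⟨⟨f, hf⟩, rfl, Lp.ext (hf.coeFn_toLp.trans h)⟩

/-- Ordinary dominated convergence for the squared distance, with majorant `bound²`. -/
lemma tendsto_toLp_of_dominated {ι : Type*} {l : Filter ι} [l.IsCountablyGenerated]
    {F : ι → Space p → Spinor} {f : Space p → Spinor} {bound : Space p → ℝ}
    (hF : ∀ i, MemLp (F i) 2 (haar p)) (hf : MemLp f 2 (haar p)) (hb : MemLp bound 2 (haar p))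
    (h_bound : ∀ i, ∀ᵐ q ∂(haar p), ‖F i q - f q‖ ≤ bound q)
    (h_lim : ∀ᵐ q ∂(haar p), Tendsto (fun i => F i q) l (𝓝 (f q))) :
    Tendsto (fun i => (hF i).toLp (F i)) l (𝓝 (hf.toLp f)) := by
  have h1 : ∀ i, ‖(hF i).toLp (F i) - hf.toLp f‖ ^ 2 = ∫ q, ‖F i q - f q‖ ^ 2 ∂(haar p) := by
    intro i
    have h := inner_toLp_toLp ((hF i).sub hf) ((hF i).sub hf)
    rw [inner_self_eq_norm_sq_to_K, MemLp.toLp_sub (hF i) hf] at h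
    have h2 : ∀ q, inner ℂ ((F i - f) q) ((F i - f) q) = ((‖F i q - f q‖ ^ 2 : ℝ) : ℂ) := by
      intro q
      rw [inner_self_eq_norm_sq_to_K]
      simp
    simp only [h2, integral_complex_ofReal] at h
    refine Complex.ofReal_injective ?_
    rw [Complex.ofReal_pow]
    exact h
  rw [tendsto_iff_norm_sub_tendsto_zero]
  have h3 : Tendsto (fun i => ‖(hF i).toLp (F i) - hf.toLp f‖ ^ 2) l (𝓝 0) := by
    simp only [h1]
    rw [← integral_zero (Space p) ℝ (μ := haar p)]
    refine tendsto_integral_filter_of_dominated_convergence (fun q => bound q ^ 2)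
      (Eventually.of_forall fun i => ?_) (Eventually.of_forall fun i => ?_) hb.integrable_sq ?_
    · exact (((hF i).sub hf).aestronglyMeasurable.norm.pow 2)
    · filter_upwards [h_bound i] with q hq
      rw [norm_pow, norm_norm]
      gcongr
    · filter_upwards [h_lim] with q hq
      have := ((tendsto_iff_norm_sub_tendsto_zero.mp hq).pow 2)
      simpa using this
  have h4 := (Real.continuous_sqrt.tendsto 0).comp h3
  simpa [Function.comp_def, Real.sqrt_sq (norm_nonneg _)] using h4

lemma memLp_mul {M : Space p → Spinor →L[ℂ] Spinor} (hM : AEStronglyMeasurable M (haar p))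
    (hn : ∀ᵐ q ∂(haar p), ∀ v, ‖M q v‖ ≤ ‖v‖) {f : Space p → Spinor} (hf : MemLp f 2 (haar p)) :
    MemLp (fun q => M q (f q)) 2 (haar p) := by
  refine hf.mono (isBoundedBilinearMap_apply.continuous.comp_aestronglyMeasurable
    (hM.prodMk hf.aestronglyMeasurable)) ?_
  filter_upwards [hn] with q hq
  exact hq _

variable {T : Space p → Spinor →L[ℂ] Spinor}

lemma continuous_expOp_comp (hT : Continuous T) (t : ℝ) : Continuous fun q => expOp (T q) t :=
  continuous_expOp.comp (hT.prodMk continuous_const)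

lemma memLp_expOp (hT : Continuous T) (hs : ∀ q, IsSelfAdjoint (T q)) (t : ℝ)
    (f : StateSpace p) : MemLp (fun q => expOp (T q) t (f q)) 2 (haar p) :=
  memLp_mul (continuous_expOp_comp hT t).aestronglyMeasurable
    (Eventually.of_forall fun q v => (norm_expOp_apply (hs q) t v).le) (Lp.memLp f)

/-- Multiplication by `e^{-itT(q)}` as a linear isometry. -/
noncomputable def expMulIsometry (hT : Continuous T) (hs : ∀ q, IsSelfAdjoint (T q)) (t : ℝ) :
    StateSpace p →ₗᵢ[ℂ] StateSpace p where
  toFun f := (memLp_expOp hT hs t f).toLp _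
  map_add' f g := by
    rw [← MemLp.toLp_add]
    exact MemLp.toLp_congr _ _ (mul_add_ae _ f g)
  map_smul' c f := by
    rw [RingHom.id_apply, ← MemLp.toLp_const_smul]
    exact MemLp.toLp_congr _ _ (mul_smul_ae _ c f)
  norm_map' f := by
    change ‖(memLp_expOp hT hs t f).toLp _‖ = ‖f‖
    rw [Lp.norm_toLp, Lp.norm_def]
    congr 1
    exact eLpNorm_congr_norm_ae (Eventually.of_forall fun q => norm_expOp_apply (hs q) t _)

lemma expMulIsometry_ae (hT : Continuous T) (hs : ∀ q, IsSelfAdjoint (T q)) (t : ℝ)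
    (f : StateSpace p) :
    expMulIsometry hT hs t f =ᵐ[haar p] fun q => expOp (T q) t (f q) :=
  (memLp_expOp hT hs t f).coeFn_toLp

lemma expMulIsometry_add (hT : Continuous T) (hs : ∀ q, IsSelfAdjoint (T q)) (s t : ℝ)
    (f : StateSpace p) :
    expMulIsometry hT hs (s + t) f = expMulIsometry hT hs s (expMulIsometry hT hs t f) := by
  refine Lp.ext ?_
  filter_upwards [expMulIsometry_ae hT hs (s + t) f, expMulIsometry_ae hT hs t f,
    expMulIsometry_ae hT hs s (expMulIsometry hT hs t f)] with q h1 h2 h3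
  rw [h1, h3, h2, expOp_add]
  rfl

lemma expMulIsometry_zero (hT : Continuous T) (hs : ∀ q, IsSelfAdjoint (T q)) (f : StateSpace p) :
    expMulIsometry hT hs 0 f = f := by
  refine Lp.ext ?_
  filter_upwards [expMulIsometry_ae hT hs 0 f] with q h1
  rw [h1, expOp_zero]
  rfl

/-- Multiplication by `e^{-itT(q)}` as a unitary operator. -/
noncomputable def expMul (hT : Continuous T) (hs : ∀ q, IsSelfAdjoint (T q)) (t : ℝ) :
    StateSpace p ≃ₗᵢ[ℂ] StateSpace p :=
  LinearIsometryEquiv.ofSurjective (expMulIsometry hT hs t) fun f =>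
    ⟨expMulIsometry hT hs (-t) f, by
      rw [← expMulIsometry_add, add_neg_cancel, expMulIsometry_zero]⟩

lemma expMul_ae (hT : Continuous T) (hs : ∀ q, IsSelfAdjoint (T q)) (t : ℝ) (f : StateSpace p) :
    expMul hT hs t f =ᵐ[haar p] fun q => expOp (T q) t (f q) :=
  expMulIsometry_ae hT hs t f

lemma tendsto_slope_expOp (A : Spinor →L[ℂ] Spinor) (v : Spinor) :
    Tendsto (fun t : ℝ => ((t⁻¹ : ℝ) : ℂ) • (expOp A t v - v)) (𝓝[≠] 0)
      (𝓝 (-Complex.I • A v)) := by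
  have h := hasDerivAt_zero_iff_tendsto.mp (hasDerivAt_expOp_apply A 0 v)
  simpa [expOp_zero] using h

/-- Strong continuity and differentiability on the natural domain follow by dominated convergence,
with majorants `2‖f‖` and `2‖T f‖`. Conversely, `L²`-convergence of the difference quotients gives
an almost everywhere convergent subsequence, whose limit must be `-iT(q)f(q)`; hence the generator
has no larger domain. -/
theorem isUnitaryGroupOf_expMul (hT : Continuous T) (hs : ∀ q, IsSelfAdjoint (T q)) :
    IsUnitaryGroupOf (mulOp T) (expMul hT hs) where
  map_add s t f := expMulIsometry_add hT hs s t f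
  continuous f := by
    refine continuous_iff_continuousAt.mpr fun t => ?_
    refine tendsto_toLp_of_dominated (bound := fun q => 2 * ‖f q‖)
      (memLp_expOp hT hs · f) (memLp_expOp hT hs t f)
      ((Lp.memLp f).norm.const_mul 2) ?_ ?_
    · refine fun s => Eventually.of_forall fun q => (norm_sub_le _ _).trans ?_
      rw [norm_expOp_apply (hs q), norm_expOp_apply (hs q), two_mul]
    · exact Eventually.of_forall fun q => (hasDerivAt_expOp_apply (T q) t (f q)).continuousAt.tendsto
  generator f g := by
    rw [mem_graph_mulOp, hasDerivAt_zero_iff_tendsto]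
    have hq : ∀ t : ℝ, MemLp (fun q => ((t⁻¹ : ℝ) : ℂ) • (expOp (T q) t (f q) - f q)) 2 (haar p) :=
      fun t => MemLp.const_smul (f := fun q => expOp (T q) t (f q) - f q)
        ((memLp_expOp hT hs t f).sub (Lp.memLp f)) ((t⁻¹ : ℝ) : ℂ)
    have hslope : ∀ t : ℝ, ((t⁻¹ : ℝ) : ℂ) • (expMul hT hs t f - expMul hT hs 0 f) =
        (hq t).toLp _ := by
      intro t
      rw [show expMul hT hs 0 f = f from expMulIsometry_zero hT hs f]
      refine Lp.ext (EventuallyEq.trans ?_ (hq t).coeFn_toLp.symm)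
      filter_upwards [Lp.coeFn_smul ((t⁻¹ : ℝ) : ℂ) (expMul hT hs t f - f),
        Lp.coeFn_sub (expMul hT hs t f) f, expMul_ae hT hs t f] with q h1 h2 h3
      rw [h1, Pi.smul_apply, h2, Pi.sub_apply, h3]
    simp only [hslope]
    constructor
    · intro h
      have hTf : MemLp (fun q => T q (f q)) 2 (haar p) := (memLp_congr_ae h).mpr (Lp.memLp g)
      have hlim : -Complex.I • g = (hTf.const_smul (-Complex.I)).toLp _ := by
        refine Lp.ext (EventuallyEq.trans ?_ (MemLp.coeFn_toLp _).symm)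
        filter_upwards [Lp.coeFn_smul (-Complex.I) g, h] with q h1 h2
        rw [h1, Pi.smul_apply, ← h2, Pi.smul_apply]
      rw [hlim]
      refine tendsto_toLp_of_dominated (bound := fun q => 2 * ‖T q (f q)‖) hq
        (hTf.const_smul (-Complex.I))
        (hTf.norm.const_mul 2) ?_ ?_
      · refine fun t => Eventually.of_forall fun q => (norm_sub_le _ _).trans ?_
        rw [two_mul]
        refine add_le_add ?_ (by rw [Pi.smul_apply, norm_smul]; simp)
        rw [norm_smul, Complex.norm_real, norm_inv, Real.norm_eq_abs]
        -- The majorant is required for every `t`; at `t = 0` the quotient is zero because `0⁻¹ =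
        -- 0`.
        rcases eq_or_ne t 0 with rfl | ht
        · simp
        · rw [inv_mul_le_iff₀ (abs_pos.mpr ht), mul_comm]
          exact norm_expOp_apply_sub_le (hs q) t _
      · exact Eventually.of_forall fun q => tendsto_slope_expOp (T q) (f q)
    · intro h
      -- Restricting to the times `1/(n+1)` gives a sequence, from which an almost everywhere
      -- convergent subsequence can be extracted.
      have hseq : Tendsto (fun n : ℕ => (((n : ℝ) + 1)⁻¹ : ℝ)) atTop (𝓝[≠] 0) := by
        refine tendsto_nhdsWithin_iff.mpr ⟨?_, Eventually.of_forall fun n => ?_⟩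
        · simpa using tendsto_one_div_add_atTop_nhds_zero_nat (𝕜 := ℝ)
        · exact inv_ne_zero (by positivity)
      obtain ⟨ns, hns, hae⟩ :=
        (tendstoInMeasure_of_tendsto_Lp (h.comp hseq)).exists_seq_tendsto_ae
      have hco : ∀ᵐ q ∂(haar p), ∀ n : ℕ,
          ((hq (((n : ℝ) + 1)⁻¹)).toLp _ : StateSpace p) q = _ :=
        ae_all_iff.mpr fun n => (hq (((n : ℝ) + 1)⁻¹)).coeFn_toLp
      filter_upwards [hae, hco, Lp.coeFn_smul (-Complex.I) g] with q h1 h2 h3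
      have h4 := (tendsto_slope_expOp (T q) (f q)).comp (hseq.comp hns.tendsto_atTop)
      have h5 : Tendsto (fun i => ((hq (((ns i : ℝ) + 1)⁻¹)).toLp _ : StateSpace p) q) atTop
          (𝓝 ((-Complex.I • g : StateSpace p) q)) := h1
      simp only [h2] at h5
      have h6 := tendsto_nhds_unique h4 h5
      rw [h3, Pi.smul_apply] at h6
      exact smul_right_injective _ (neg_ne_zero.mpr Complex.I_ne_zero) h6

end Multiplication

end PadicDirac

namespace PadicDirac

/-! ### The Dirac matrices -/

section DiracMatrices

lemma isHermitian_alpha (k : Fin 3) : (alpha k).IsHermitian := by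
  ext i j
  fin_cases k <;> fin_cases i <;> fin_cases j <;> simp [alpha]

lemma isHermitian_beta : beta.IsHermitian := by
  refine Matrix.isHermitian_diagonal_of_self_adjoint _ ?_
  ext i
  fin_cases i <;> simp

lemma beta_mul_beta : beta * beta = 1 := by
  rw [beta, Matrix.diagonal_mul_diagonal, ← Matrix.diagonal_one]
  congr 1
  ext i
  fin_cases i <;> simp

lemma beta_mul_alpha (k : Fin 3) : beta * alpha k = -(alpha k * beta) := by
  ext i j
  rw [beta, Matrix.neg_apply, Matrix.diagonal_mul, Matrix.mul_diagonal]
  fin_cases k <;> fin_cases i <;> fin_cases j <;> simp [alpha]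

/-- The relations `αⱼαₖ + αₖαⱼ = 2δⱼₖ` packed into one quadratic identity and checked on entries. -/
lemma sum_smul_alpha_sq (c : Fin 3 → ℂ) :
    (∑ k, c k • alpha k) * (∑ k, c k • alpha k) = (∑ k, c k ^ 2) • (1 : Matrix (Fin 4) (Fin 4) ℂ) := by
  have h : ∑ k, c k • alpha k = !![0, 0, c 2, c 0 - Complex.I * c 1;
      0, 0, c 0 + Complex.I * c 1, -c 2; c 2, c 0 - Complex.I * c 1, 0, 0;
      c 0 + Complex.I * c 1, -c 2, 0, 0] := by
    ext i j
    fin_cases i <;> fin_cases j <;> simp [alpha, Fin.sum_univ_three] <;> ring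
  rw [h]
  ext i j
  fin_cases i <;> fin_cases j <;>
    simp [Matrix.mul_apply, Fin.sum_univ_four, Fin.sum_univ_three] <;> ring_nf <;>
    simp [Complex.I_sq]

variable {p : ℕ} [Fact p.Prime]

lemma isHermitian_alphaDot (q : Space p) : (alphaDot q).IsHermitian := by
  rw [Matrix.IsHermitian, alphaDot, Matrix.conjTranspose_sum]
  refine Finset.sum_congr rfl fun k _ => ?_
  rw [Matrix.conjTranspose_smul, (isHermitian_alpha k).eq]
  simp

lemma isHermitian_symbol (m : ℝ) (q : Space p) : (symbol m q).IsHermitian := by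
  refine (isHermitian_alphaDot q).add ?_
  rw [Matrix.IsHermitian, Matrix.conjTranspose_smul, isHermitian_beta.eq]
  simp

lemma beta_mul_alphaDot (q : Space p) : beta * alphaDot q = -(alphaDot q * beta) := by
  rw [alphaDot, Finset.mul_sum, Finset.sum_mul, ← Finset.sum_neg_distrib]
  refine Finset.sum_congr rfl fun k _ => ?_
  rw [Matrix.mul_smul, Matrix.smul_mul, beta_mul_alpha, smul_neg]

lemma energy_sq (m : ℝ) (q : Space p) : energy m q ^ 2 = ∑ k, ‖q k‖ ^ 2 + m ^ 2 :=
  Real.sq_sqrt (by positivity)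

lemma energy_nonneg (m : ℝ) (q : Space p) : 0 ≤ energy m q := Real.sqrt_nonneg _

lemma alphaDot_sq (m : ℝ) (q : Space p) : alphaDot q * alphaDot q =
    ((energy m q : ℂ) ^ 2 - (m : ℂ) ^ 2) • (1 : Matrix (Fin 4) (Fin 4) ℂ) := by
  rw [alphaDot, sum_smul_alpha_sq]
  congr 1
  have := congrArg (fun x : ℝ => (x : ℂ)) (energy_sq m q)
  push_cast at this
  rw [this]
  ring

/-- The cross terms cancel because `β` anticommutes with `α · |q|`. -/
lemma symbol_mul_symbol (m : ℝ) (q : Space p) :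
    symbol m q * symbol m q = ((energy m q : ℂ) ^ 2) • (1 : Matrix (Fin 4) (Fin 4) ℂ) := by
  rw [symbol, mul_add, add_mul, add_mul, alphaDot_sq m, Matrix.smul_mul, Matrix.mul_smul,
    beta_mul_alphaDot, Matrix.smul_mul, Matrix.mul_smul, beta_mul_beta]
  module

lemma norm_apply_le_energy (m : ℝ) (q : Space p) (k : Fin 3) : ‖q k‖ ≤ energy m q := by
  refine Real.le_sqrt_of_sq_le ?_
  have := Finset.single_le_sum (f := fun k => ‖q k‖ ^ 2) (fun i _ => by positivity)
    (Finset.mem_univ k)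
  nlinarith [sq_nonneg m]

lemma norm_le_energy (m : ℝ) (q : Space p) : ‖q‖ ≤ energy m q :=
  (pi_norm_le_iff_of_nonneg (energy_nonneg m q)).mpr (norm_apply_le_energy m q)

lemma energy_pos (m : ℝ) {q : Space p} (hq : q ≠ 0) : 0 < energy m q :=
  (norm_pos_iff.mpr hq).trans_le (norm_le_energy m q)

/-- A nonzero coordinate forces `λ(q) > |m|`, which covers negative `m` too. -/
lemma add_energy_pos (m : ℝ) {q : Space p} (hq : q ≠ 0) : 0 < m + energy m q := by
  obtain ⟨k, hk⟩ := Function.ne_iff.mp hq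
  have hk : 0 < ‖q k‖ := norm_pos_iff.mpr hk
  have h := Finset.single_le_sum (f := fun k => ‖q k‖ ^ 2) (fun i _ => by positivity)
    (Finset.mem_univ k)
  have h1 := energy_sq m q
  have h2 : |m| < energy m q := abs_lt_of_sq_lt_sq (by nlinarith [pow_pos hk 2])
    (energy_nonneg m q)
  linarith [neg_abs_le m]

lemma continuous_energy (m : ℝ) : Continuous (energy m : Space p → ℝ) := by
  unfold energy
  fun_prop

lemma isSelfAdjoint_matOp {A : Matrix (Fin 4) (Fin 4) ℂ} (hA : A.IsHermitian) :
    IsSelfAdjoint (matOp A) :=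
  IsSelfAdjoint.map (f := Matrix.toEuclideanCLM (n := Fin 4) (𝕜 := ℂ)) hA

lemma matOp_mul_apply (A B : Matrix (Fin 4) (Fin 4) ℂ) (v : Spinor) :
    matOp A (matOp B v) = matOp (A * B) v := by
  rw [matOp, matOp, matOp, map_mul]
  rfl

lemma matOp_symbol_matOp_symbol (m : ℝ) (q : Space p) (v : Spinor) :
    matOp (symbol m q) (matOp (symbol m q) v) = ((energy m q : ℂ) ^ 2) • v := by
  rw [matOp_mul_apply, symbol_mul_symbol, matOp, _root_.map_smul, map_one]
  rfl

/-- A Hermitian matrix with square `λ²` scales every norm by `λ`. Multiplication by `h` therefore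
has the same natural domain as multiplication by `λ`. -/
lemma norm_matOp_symbol (m : ℝ) (q : Space p) (v : Spinor) :
    ‖matOp (symbol m q) v‖ = energy m q * ‖v‖ := by
  have h : inner ℂ (matOp (symbol m q) v) (matOp (symbol m q) v) =
      inner ℂ v (matOp (symbol m q) (matOp (symbol m q) v)) :=
    (isSelfAdjoint_matOp (isHermitian_symbol m q)).isSymmetric _ _
  rw [matOp_symbol_matOp_symbol, inner_smul_right, inner_self_eq_norm_sq_to_K,
    inner_self_eq_norm_sq_to_K] at h
  have h2 : ‖matOp (symbol m q) v‖ ^ 2 = (energy m q * ‖v‖) ^ 2 := by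
    rw [mul_pow]
    refine Complex.ofReal_injective ?_
    push_cast
    exact h
  exact (sq_eq_sq₀ (norm_nonneg _) (mul_nonneg (energy_nonneg m q) (norm_nonneg _))).mp h2

lemma matOp_symbol_eq (m : ℝ) (q : Space p) : matOp (symbol m q) =
    ∑ k, (‖q k‖ : ℂ) • matOp (alpha k) + (m : ℂ) • matOp beta := by
  rw [symbol, alphaDot]
  simp only [matOp, map_add, map_sum, _root_.map_smul]

lemma continuous_matOp_symbol (m : ℝ) : Continuous fun q : Space p => matOp (symbol m q) := by
  simp only [matOp_symbol_eq]
  fun_prop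

lemma projSymbol_apply (m σ : ℝ) (q : Space p) (v : Spinor) : projSymbol m σ q v =
    ((2 * energy m q : ℝ) : ℂ)⁻¹ • ((energy m q : ℂ) • v + (σ : ℂ) • matOp (symbol m q) v) := by
  simp only [projSymbol, matOp, map_add, _root_.map_smul, map_one]
  rfl

/-- For `σ² = 1`, `h(λ + σh) = λh + σλ² = σλ(λ + σh)`. Where `λ = 0` both sides vanish, the inverse
factor being zero. -/
lemma matOp_symbol_projSymbol (m : ℝ) {σ : ℝ} (hσ : σ = 1 ∨ σ = -1) (q : Space p) (v : Spinor) :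
    matOp (symbol m q) (projSymbol m σ q v) = ((σ * energy m q : ℝ) : ℂ) • projSymbol m σ q v := by
  have hσ2 : (σ : ℂ) * σ = 1 := by rcases hσ with rfl | rfl <;> simp
  rw [projSymbol_apply, _root_.map_smul, map_add, _root_.map_smul, _root_.map_smul,
    matOp_symbol_matOp_symbol, smul_comm _ (_ : ℂ)⁻¹]
  congr 1
  rw [smul_add, smul_smul, smul_smul, smul_smul, add_comm]
  push_cast
  congr 2
  · ring
  · linear_combination (-(energy m q : ℂ)) * hσ2

lemma norm_projSymbol_apply_le (m : ℝ) {σ : ℝ} (hσ : σ = 1 ∨ σ = -1) (q : Space p) (v : Spinor) :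
    ‖projSymbol m σ q v‖ ≤ ‖v‖ := by
  have hσ1 : ‖(σ : ℂ)‖ = 1 := by rcases hσ with rfl | rfl <;> simp
  have he := energy_nonneg m q
  rw [projSymbol_apply, norm_smul, norm_inv, Complex.norm_real, Real.norm_of_nonneg (by positivity)]
  have h : ‖(energy m q : ℂ) • v + (σ : ℂ) • matOp (symbol m q) v‖ ≤ 2 * energy m q * ‖v‖ := by
    refine (norm_add_le _ _).trans ?_
    rw [norm_smul, norm_smul, hσ1, norm_matOp_symbol, Complex.norm_real, Real.norm_of_nonneg he]
    linarith
  -- At zero energy the factor `(2λ)⁻¹` is `0` by convention, so the bound still holds.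
  rcases he.eq_or_lt with h0 | h0
  · rw [← h0]; simp
  · rw [inv_mul_le_iff₀ (by positivity)]
    exact h

lemma norm_projSymbol_le (m : ℝ) {σ : ℝ} (hσ : σ = 1 ∨ σ = -1) (q : Space p) :
    ‖projSymbol m σ q‖ ≤ 1 :=
  ContinuousLinearMap.opNorm_le_bound _ zero_le_one fun v => by
    simpa using norm_projSymbol_apply_le m hσ q v

lemma aestronglyMeasurable_projSymbol (m σ : ℝ) :
    AEStronglyMeasurable (projSymbol (p := p) m σ) (haar p) := by
  have h : projSymbol (p := p) m σ = fun q => ((2 * energy m q : ℝ) : ℂ)⁻¹ •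
      ((energy m q : ℂ) • (1 : Spinor →L[ℂ] Spinor) + (σ : ℂ) • matOp (symbol m q)) := by
    funext q
    simp only [projSymbol, matOp, map_add, _root_.map_smul, map_one]
  rw [h]
  have h1 := continuous_energy (p := p) m
  have h2 := continuous_matOp_symbol (p := p) m
  have h3 : Continuous fun q : Space p => (energy m q : ℂ) • (1 : Spinor →L[ℂ] Spinor) +
      (σ : ℂ) • matOp (symbol m q) := by fun_prop
  have h4 : Measurable fun q : Space p => ((2 * energy m q : ℝ) : ℂ)⁻¹ :=
    (Complex.continuous_ofReal.comp (h1.const_mul 2)).measurable.inv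
  exact h4.aestronglyMeasurable.smul h3.aestronglyMeasurable

/-! ### The diagonalizing matrix -/

lemma ae_ne_zero : ∀ᵐ q ∂(haar p), q ≠ 0 := by
  have : (𝓝[≠] (0 : Space p)).NeBot := Module.punctured_nhds_neBot ℚ_[p] (Space p) 0
  have : NullSingletonClass (haar p) := inferInstance
  simp [ae_iff]

/-- The adjoint of the diagonalizing matrix. -/
noncomputable def diagonalizerAdj (m : ℝ) (q : Space p) : Matrix (Fin 4) (Fin 4) ℂ :=
  ((Real.sqrt (2 * energy m q * (m + energy m q)) : ℝ) : ℂ)⁻¹ •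
    (((m + energy m q : ℝ) : ℂ) • (1 : Matrix (Fin 4) (Fin 4) ℂ) - beta * alphaDot q)

lemma star_diagonalizer (m : ℝ) (q : Space p) : star (diagonalizer m q) = diagonalizerAdj m q := by
  rw [diagonalizer, diagonalizerAdj, star_smul, star_add, star_smul, star_mul, star_one,
    Matrix.star_eq_conjTranspose, Matrix.star_eq_conjTranspose, isHermitian_beta.eq,
    (isHermitian_alphaDot q).eq, beta_mul_alphaDot]
  simp [Complex.conj_ofReal]

lemma inv_sqrt_mul_inv_sqrt (m : ℝ) {q : Space p} (hq : q ≠ 0) :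
    ((Real.sqrt (2 * energy m q * (m + energy m q)) : ℝ) : ℂ)⁻¹ *
      ((Real.sqrt (2 * energy m q * (m + energy m q)) : ℝ) : ℂ)⁻¹ =
      (2 * (energy m q : ℂ) * (m + energy m q))⁻¹ := by
  have h1 := energy_pos m hq
  have h2 := add_energy_pos m hq
  rw [← mul_inv, ← Complex.ofReal_mul, Real.mul_self_sqrt (by positivity)]
  push_cast
  rfl

lemma beta_alphaDot_sq (m : ℝ) (q : Space p) : beta * alphaDot q * (beta * alphaDot q) =
    (-((energy m q : ℂ) ^ 2 - (m : ℂ) ^ 2)) • (1 : Matrix (Fin 4) (Fin 4) ℂ) := by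
  rw [show beta * alphaDot q * (beta * alphaDot q) = beta * (alphaDot q * beta) * alphaDot q by
    simp only [mul_assoc], ← neg_eq_iff_eq_neg.mpr (beta_mul_alphaDot q), mul_neg, ← mul_assoc,
    beta_mul_beta, one_mul, neg_mul, alphaDot_sq m, neg_smul]

/-- Since `(β α·|q|)² = -(λ² - m²)`, the unnormalized product is `(m+λ)² + (λ² - m²) = 2λ(m+λ)`,
which the square-root factors cancel. -/
lemma diagonalizerAdj_mul_diagonalizer (m : ℝ) {q : Space p} (hq : q ≠ 0) :
    diagonalizerAdj m q * diagonalizer m q = 1 := by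
  have h1 : (energy m q : ℂ) ≠ 0 := by exact_mod_cast (energy_pos m hq).ne'
  have h2 : (m + energy m q : ℂ) ≠ 0 := by exact_mod_cast (add_energy_pos m hq).ne'
  rw [diagonalizer, diagonalizerAdj, Matrix.smul_mul, Matrix.mul_smul, smul_smul,
    inv_sqrt_mul_inv_sqrt m hq]
  set N := (2 * (energy m q : ℂ) * (m + energy m q))⁻¹ with hN
  rw [sub_mul, mul_add, mul_add, beta_alphaDot_sq m]
  simp only [Matrix.smul_mul, Matrix.mul_smul, one_mul, mul_one, smul_smul]
  push_cast
  have h3 : N * ((m + energy m q) * (m + energy m q) + ((energy m q : ℂ) ^ 2 - (m : ℂ) ^ 2)) = 1 := by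
    rw [hN, inv_mul_eq_one₀ (by simp [h1, h2])]
    ring
  calc _ = (N * ((m + energy m q) * (m + energy m q) + ((energy m q : ℂ) ^ 2 - (m : ℂ) ^ 2))) •
        (1 : Matrix (Fin 4) (Fin 4) ℂ) := by module
    _ = 1 := by rw [h3, one_smul]

lemma inv_diagonalizer (m : ℝ) {q : Space p} (hq : q ≠ 0) :
    (diagonalizer m q)⁻¹ = diagonalizerAdj m q :=
  Matrix.inv_eq_left_inv (diagonalizerAdj_mul_diagonalizer m hq)

/-- The unnormalized product has `β`-coefficient `(m+λ)² - (λ² - m²) = 2m(m+λ)` and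
`α·|q|`-coefficient `2(m+λ)`; division by `2λ(m+λ)` leaves `h/λ`. -/
lemma diagonalizerAdj_mul_beta_mul_diagonalizer (m : ℝ) {q : Space p} (hq : q ≠ 0) :
    diagonalizerAdj m q * (beta * diagonalizer m q) = (energy m q : ℂ)⁻¹ • symbol m q := by
  have h1 : (energy m q : ℂ) ≠ 0 := by exact_mod_cast (energy_pos m hq).ne'
  have h2 : (m + energy m q : ℂ) ≠ 0 := by exact_mod_cast (add_energy_pos m hq).ne'
  have h4 : beta * (beta * alphaDot q) = alphaDot q := by
    rw [← mul_assoc, beta_mul_beta, one_mul]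
  have h5 : beta * alphaDot q * beta = -alphaDot q := by
    rw [beta_mul_alphaDot, neg_mul, mul_assoc, beta_mul_beta, mul_one]
  have h6 : beta * alphaDot q * alphaDot q = ((energy m q : ℂ) ^ 2 - (m : ℂ) ^ 2) • beta := by
    rw [mul_assoc, alphaDot_sq m, Matrix.mul_smul, mul_one]
  rw [diagonalizer, diagonalizerAdj, Matrix.mul_smul, Matrix.smul_mul, Matrix.mul_smul, smul_smul,
    inv_sqrt_mul_inv_sqrt m hq]
  set N := (2 * (energy m q : ℂ) * (m + energy m q))⁻¹ with hN
  rw [mul_add, h4, sub_mul, mul_add, mul_add, h6]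
  simp only [Matrix.smul_mul, Matrix.mul_smul, one_mul, mul_one, smul_smul, h5]
  push_cast
  rw [symbol]
  calc _ = (N * ((m + energy m q) * (m + energy m q) - ((energy m q : ℂ) ^ 2 - (m : ℂ) ^ 2))) • beta +
        (N * (2 * (m + energy m q))) • alphaDot q := by
          module
    _ = ((energy m q : ℂ)⁻¹ * m) • beta + (energy m q : ℂ)⁻¹ • alphaDot q := by
      rw [hN]
      congr 2
      · field_simp
        ring
      · field_simp
    _ = _ := by module

lemma matOp_conj_diagonalizer (m σ : ℝ) {q : Space p} (hq : q ≠ 0) (v : Spinor) :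
    matOp (diagonalizer m q)⁻¹ (matOp ((1 / 2 : ℂ) • (1 + (σ : ℂ) • beta))
      (matOp (diagonalizer m q) v)) = projSymbol m σ q v := by
  have h1 : (energy m q : ℂ) ≠ 0 := by exact_mod_cast (energy_pos m hq).ne'
  rw [inv_diagonalizer m hq, matOp_mul_apply, matOp_mul_apply, mul_assoc, projSymbol]
  have : diagonalizerAdj m q * ((1 / 2 : ℂ) • (1 + (σ : ℂ) • beta) * diagonalizer m q) =
      ((2 * energy m q : ℝ) : ℂ)⁻¹ • ((energy m q : ℂ) • 1 + (σ : ℂ) • symbol m q) := by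
    rw [Matrix.smul_mul, Matrix.mul_smul, add_mul, one_mul, mul_add, Matrix.smul_mul,
      Matrix.mul_smul, diagonalizerAdj_mul_beta_mul_diagonalizer m hq,
      diagonalizerAdj_mul_diagonalizer m hq, smul_add, smul_add, smul_smul, smul_smul, smul_smul,
      smul_smul]
    push_cast
    congr 2
    · field_simp
    · field_simp
  rw [this, matOp, _root_.map_smul]

lemma matOp_mem_unitary_of_mul_eq_one {A B : Matrix (Fin 4) (Fin 4) ℂ} (hs : star A = B)
    (h : B * A = 1) : matOp A ∈ unitary (Spinor →L[ℂ] Spinor) ∧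
      matOp B ∈ unitary (Spinor →L[ℂ] Spinor) := by
  have hA : A ∈ unitary (Matrix (Fin 4) (Fin 4) ℂ) :=
    ⟨by rw [hs, h], by rw [hs]; exact mul_eq_one_comm.mp h⟩
  have hB : B ∈ unitary (Matrix (Fin 4) (Fin 4) ℂ) := hs ▸ Unitary.star_mem hA
  exact ⟨Unitary.map_mem (Matrix.toEuclideanCLM (n := Fin 4) (𝕜 := ℂ)) hA,
    Unitary.map_mem (Matrix.toEuclideanCLM (n := Fin 4) (𝕜 := ℂ)) hB⟩

lemma matOp_diagonalizer_mem_unitary (m : ℝ) {q : Space p} (hq : q ≠ 0) :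
    matOp (diagonalizer m q) ∈ unitary (Spinor →L[ℂ] Spinor) ∧
      matOp (diagonalizer m q)⁻¹ ∈ unitary (Spinor →L[ℂ] Spinor) := by
  rw [inv_diagonalizer m hq]
  exact matOp_mem_unitary_of_mul_eq_one (star_diagonalizer m q)
    (diagonalizerAdj_mul_diagonalizer m hq)

end DiracMatrices

end PadicDirac

namespace PadicDirac

section Evolution

variable {p : ℕ} [Fact p.Prime]

/-! ### The energy projections in momentum space -/

/-- Pointwise unitarity keeps the product in `L²`, which excludes the default value in `mulMatrix`.
-/
lemma mulMatrix_ae {M : Space p → Matrix (Fin 4) (Fin 4) ℂ}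
    (hM : AEStronglyMeasurable (fun q => matOp (M q)) (haar p))
    (hu : ∀ᵐ q ∂(haar p), matOp (M q) ∈ unitary (Spinor →L[ℂ] Spinor)) (f : StateSpace p) :
    mulMatrix M f =ᵐ[haar p] fun q => matOp (M q) (f q) := by
  have h : MemLp (fun q => matOp (M q) (f q)) 2 (haar p) := by
    refine memLp_mul (M := fun q => matOp (M q)) hM ?_ (Lp.memLp f)
    filter_upwards [hu] with q hq v
    exact (ContinuousLinearMap.norm_map_of_mem_unitary hq v).le
  have h' : f ∈ (mulOp fun q => matOp (M q)).domain := h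
  rw [mulMatrix, dif_pos h']
  exact h.coeFn_toLp

lemma aestronglyMeasurable_diagonalizer (m : ℝ) :
    AEStronglyMeasurable (fun q : Space p => matOp (diagonalizer m q)) (haar p) ∧
      AEStronglyMeasurable (fun q : Space p => matOp (diagonalizer m q)⁻¹) (haar p) := by
  have h1 := continuous_energy (p := p) m
  have h2 : Continuous fun q : Space p => matOp (alphaDot q) := by
    have : (fun q : Space p => matOp (alphaDot q)) = fun q => matOp (symbol 0 q) := by
      funext q
      simp [symbol]
    rw [this]
    exact continuous_matOp_symbol 0
  have h3 : Measurable fun q : Space p =>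
      ((Real.sqrt (2 * energy m q * (m + energy m q)) : ℝ) : ℂ)⁻¹ := by
    have : Continuous fun q : Space p =>
      ((Real.sqrt (2 * energy m q * (m + energy m q)) : ℝ) : ℂ) := by fun_prop
    exact this.measurable.inv
  have h4 : ∀ s : ℂ, Continuous fun q : Space p => ((m + energy m q : ℝ) : ℂ) •
      (1 : Spinor →L[ℂ] Spinor) + s • (matOp beta * matOp (alphaDot q)) := by
    intro s
    fun_prop
  constructor
  · refine (h3.aestronglyMeasurable.smul (h4 1).aestronglyMeasurable).congr
      (Eventually.of_forall fun q => ?_)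
    simp only [Pi.smul_apply', diagonalizer, matOp, _root_.map_smul, map_add, map_mul, map_one,
      one_smul]
  · refine (h3.aestronglyMeasurable.smul (h4 (-1)).aestronglyMeasurable).congr ?_
    filter_upwards [ae_ne_zero] with q hq
    rw [inv_diagonalizer m hq]
    simp only [Pi.smul_apply', diagonalizerAdj, matOp, _root_.map_smul, map_sub, map_mul, map_one]
    module

lemma fourierEquiv_energyProj_ae (m σ : ℝ) (ψ : StateSpace p) :
    fourierEquiv p (energyProj m σ ψ) =ᵐ[haar p] fun q => projSymbol m σ q (fourierEquiv p ψ q) := by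
  rw [energyProj, diagTransformInv, fourierL2Inv_apply, LinearIsometryEquiv.apply_symm_apply,
    diagTransform]
  obtain ⟨hm1, hm2⟩ := aestronglyMeasurable_diagonalizer (p := p) m
  have hu1 : ∀ᵐ q ∂(haar p), matOp (diagonalizer m q) ∈ unitary (Spinor →L[ℂ] Spinor) := by
    filter_upwards [ae_ne_zero] with q hq
    exact (matOp_diagonalizer_mem_unitary m hq).1
  have hu2 : ∀ᵐ q ∂(haar p), matOp (diagonalizer m q)⁻¹ ∈ unitary (Spinor →L[ℂ] Spinor) := by
    filter_upwards [ae_ne_zero] with q hq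
    exact (matOp_diagonalizer_mem_unitary m hq).2
  have h1 := mulMatrix_ae hm1 hu1 (fourierL2 p ψ)
  have h2 := (matOp ((1 / 2 : ℂ) • (1 + (σ : ℂ) • beta))).coeFn_compLpL
    (mulMatrix (diagonalizer m) (fourierL2 p ψ))
  have h3 := mulMatrix_ae hm2 hu2 (constOp p ((1 / 2 : ℂ) • (1 + (σ : ℂ) • beta))
    (mulMatrix (diagonalizer m) (fourierL2 p ψ)))
  filter_upwards [h1, h2, h3, ae_ne_zero] with q h1 h2 h3 hq
  rw [h3, ← matOp_conj_diagonalizer m σ hq, fourierEquiv_apply, ← h1, ← h2]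
  rfl

/-! ### The Hamiltonian in momentum space -/

lemma mem_domain_vladimirov {k : Fin 3} {φ : StateSpace p} :
    φ ∈ (vladimirov p k).domain ↔ MemLp (fun q => (‖q k‖ : ℂ) • fourierEquiv p φ q) 2 (haar p) :=
  Iff.rfl

lemma fourierEquiv_vladimirov_ae {k : Fin 3} {φ : StateSpace p} (hφ : φ ∈ (vladimirov p k).domain) :
    fourierEquiv p (vladimirov p k ⟨φ, hφ⟩) =ᵐ[haar p]
      fun q => (‖q k‖ : ℂ) • fourierEquiv p φ q := by
  have h : vladimirov p k ⟨φ, hφ⟩ =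
      fourierL2Inv p ((mem_domain_vladimirov.mp hφ).toLp _) := rfl
  rw [h, fourierL2Inv_apply, LinearIsometryEquiv.apply_symm_apply]
  exact MemLp.coeFn_toLp _

lemma mem_domain_hamiltonian {m : ℝ} {φ : StateSpace p} :
    φ ∈ (hamiltonian p m).domain ↔ ∀ k, φ ∈ (vladimirov p k).domain := by
  have : φ ∈ (hamiltonian p m).domain ↔ ((φ ∈ (vladimirov p 0).domain ∧
      φ ∈ (vladimirov p 1).domain) ∧ φ ∈ (vladimirov p 2).domain) ∧ True := Iff.rfl
  rw [this, Fin.forall_fin_succ, Fin.forall_fin_succ, Fin.forall_fin_succ]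
  simp [and_assoc]

lemma fourierEquiv_constOp_ae (A : Matrix (Fin 4) (Fin 4) ℂ) (φ : StateSpace p) :
    fourierEquiv p (constOp p A φ) =ᵐ[haar p] fun q => matOp A (fourierEquiv p φ q) := by
  rw [fourierEquiv_apply, constOp_fourierL2]
  exact (matOp A).coeFn_compLpL _

lemma fourierEquiv_hamiltonian_ae {m : ℝ} {φ : StateSpace p}
    (hφ : φ ∈ (hamiltonian p m).domain) :
    fourierEquiv p (hamiltonian p m ⟨φ, hφ⟩) =ᵐ[haar p]
      fun q => matOp (symbol m q) (fourierEquiv p φ q) := by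
  have hk := mem_domain_hamiltonian.mp hφ
  have h : hamiltonian p m ⟨φ, hφ⟩ = constOp p (alpha 0) (vladimirov p 0 ⟨φ, hk 0⟩) +
      constOp p (alpha 1) (vladimirov p 1 ⟨φ, hk 1⟩) +
      constOp p (alpha 2) (vladimirov p 2 ⟨φ, hk 2⟩) + constOp p ((m : ℂ) • beta) φ := rfl
  rw [h, map_add, map_add, map_add]
  filter_upwards [Lp.coeFn_add (fourierEquiv p (constOp p (alpha 0) (vladimirov p 0 ⟨φ, hk 0⟩)) +
      fourierEquiv p (constOp p (alpha 1) (vladimirov p 1 ⟨φ, hk 1⟩)) +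
      fourierEquiv p (constOp p (alpha 2) (vladimirov p 2 ⟨φ, hk 2⟩)))
      (fourierEquiv p (constOp p ((m : ℂ) • beta) φ)),
    Lp.coeFn_add (fourierEquiv p (constOp p (alpha 0) (vladimirov p 0 ⟨φ, hk 0⟩)) +
      fourierEquiv p (constOp p (alpha 1) (vladimirov p 1 ⟨φ, hk 1⟩)))
      (fourierEquiv p (constOp p (alpha 2) (vladimirov p 2 ⟨φ, hk 2⟩))),
    Lp.coeFn_add (fourierEquiv p (constOp p (alpha 0) (vladimirov p 0 ⟨φ, hk 0⟩)))
      (fourierEquiv p (constOp p (alpha 1) (vladimirov p 1 ⟨φ, hk 1⟩))),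
    fourierEquiv_constOp_ae (alpha 0) (vladimirov p 0 ⟨φ, hk 0⟩),
    fourierEquiv_constOp_ae (alpha 1) (vladimirov p 1 ⟨φ, hk 1⟩),
    fourierEquiv_constOp_ae (alpha 2) (vladimirov p 2 ⟨φ, hk 2⟩),
    fourierEquiv_constOp_ae ((m : ℂ) • beta) φ,
    fourierEquiv_vladimirov_ae (hk 0), fourierEquiv_vladimirov_ae (hk 1),
    fourierEquiv_vladimirov_ae (hk 2)] with q a1 a2 a3 b0 b1 b2 b3 c0 c1 c2
  rw [a1, Pi.add_apply, a2, Pi.add_apply, a3, Pi.add_apply, b0, b1, b2, b3, c0, c1, c2,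
    matOp_symbol_eq, Fin.sum_univ_three]
  simp only [matOp, _root_.map_smul, add_apply, smul_apply]

/-- The point is the equality of domains: from `‖h(q)v‖ = λ(q)‖v‖` and `|q_k| ≤ λ(q)`,
square-integrability of `h φ̂` forces that of each `|q_k| φ̂`. -/
lemma mem_graph_hamiltonian {m : ℝ} (φ η : StateSpace p) :
    (φ, η) ∈ (hamiltonian p m).graph ↔
      (fourierEquiv p φ, fourierEquiv p η) ∈ (mulOp fun q : Space p => matOp (symbol m q)).graph := by
  rw [mem_graph_mulOp, LinearPMap.mem_graph_iff]
  constructor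
  · rintro ⟨⟨φ', hφ⟩, rfl, h⟩
    have h' : hamiltonian p m ⟨φ', hφ⟩ = η := h
    rw [← h']
    exact (fourierEquiv_hamiltonian_ae hφ).symm
  · intro h
    have hφ : φ ∈ (hamiltonian p m).domain := by
      refine mem_domain_hamiltonian.mpr fun k => mem_domain_vladimirov.mpr ?_
      have hM : MemLp (fun q => matOp (symbol m q) (fourierEquiv p φ q)) 2 (haar p) :=
        (memLp_congr_ae h).mpr (Lp.memLp _)
      have hc : Continuous fun q : Space p => (‖q k‖ : ℂ) := by fun_prop
      refine hM.mono (hc.aestronglyMeasurable.smul (Lp.aestronglyMeasurable _)) ?_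
      refine Eventually.of_forall fun q => ?_
      rw [norm_smul, norm_matOp_symbol, Complex.norm_real, norm_norm]
      gcongr
      exact norm_apply_le_energy m q k
    refine ⟨⟨φ, hφ⟩, rfl, (fourierEquiv p).injective (Lp.ext ?_)⟩
    exact (fourierEquiv_hamiltonian_ae hφ).trans h

lemma IsSchwartzBruhat.fourierEquiv_toLp_ae {M : ℤ} {f : Space p → Spinor}
    (hf : IsSchwartzBruhat M f) :
    fourierEquiv p (hf.memLp.toLp f) =ᵐ[haar p] PadicDirac.fourier f := by
  rw [fourierEquiv_apply, hf.fourierL2_toLp]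
  exact MemLp.coeFn_toLp _

lemma IsSchwartzBruhat.toLp_mem_domain_vladimirov {M : ℤ} {f : Space p → Spinor}
    (hf : IsSchwartzBruhat M f) (k : Fin 3) : hf.memLp.toLp f ∈ (vladimirov p k).domain := by
  have hk : Continuous fun q : Space p => (‖q k‖ : ℂ) := by fun_prop
  have hm : MemLp (fun q : Space p => (‖q k‖ : ℂ) • PadicDirac.fourier f q) 2 (haar p) :=
    (hk.smul hf.fourier.continuous).memLp_of_hasCompactSupport
      (hf.fourier.hasCompactSupport.mono fun q hq h => hq (by simp [h]))
  have hae : (fun q : Space p => (‖q k‖ : ℂ) • PadicDirac.fourier f q) =ᵐ[haar p]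
      fun q => (‖q k‖ : ℂ) • fourierEquiv p (hf.memLp.toLp f) q := by
    filter_upwards [hf.fourierEquiv_toLp_ae] with q hq
    rw [hq]
  have hm' := hm.ae_eq hae
  exact mem_domain_vladimirov.mpr hm'

lemma schwartzBruhat_le_domain_hamiltonian (m : ℝ) :
    schwartzBruhat p ≤ (hamiltonian p m).domain := by
  intro φ hφ
  obtain ⟨M, g, hg, h⟩ := exists_toLp_of_mem_schwartzBruhat hφ
  rw [h]
  exact mem_domain_hamiltonian.mpr hg.toLp_mem_domain_vladimirov

lemma dense_domain_hamiltonian (m : ℝ) : Dense ((hamiltonian p m).domain : Set (StateSpace p)) :=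
  dense_schwartzBruhat.mono (schwartzBruhat_le_domain_hamiltonian m)

/-- The unitary group of the Hamiltonian is multiplication by `e^{-ith(q)}` in momentum space. -/
lemma fourierEquiv_expNegI_ae (m t : ℝ) (φ : StateSpace p) :
    fourierEquiv p (expNegI (hamiltonian p m) t φ) =ᵐ[haar p]
      fun q => expOp (matOp (symbol m q)) t (fourierEquiv p φ q) := by
  have hs : ∀ q : Space p, IsSelfAdjoint (matOp (symbol m q)) :=
    fun q => isSelfAdjoint_matOp (isHermitian_symbol m q)
  have hU := (isUnitaryGroupOf_expMul (continuous_matOp_symbol m) hs).conj (fourierEquiv p)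
    (B := hamiltonian p m) mem_graph_hamiltonian
  rw [expNegI_eq (dense_domain_hamiltonian m) hU]
  simp only [LinearIsometryEquiv.trans_apply, LinearIsometryEquiv.apply_symm_apply]
  exact expMul_ae _ hs t _

/-! ### The evolution of the energy components -/

/-- The momentum amplitude `e^{-iσλ(q)t} (λ(q) + σ h(q)) / (2 λ(q)) g(q)`. -/
noncomputable def amplitude (m σ t : ℝ) (g : Space p → Spinor) (q : Space p) : Spinor :=
  Complex.exp (-Complex.I * σ * energy m q * t) • projSymbol m σ q (g q)

lemma aestronglyMeasurable_projSymbol_apply (m σ : ℝ) {g : Space p → Spinor}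
    (hg : AEStronglyMeasurable g (haar p)) :
    AEStronglyMeasurable (fun q => projSymbol m σ q (g q)) (haar p) :=
  isBoundedBilinearMap_apply.continuous.comp_aestronglyMeasurable
    ((aestronglyMeasurable_projSymbol m σ).prodMk hg)

lemma norm_exp_energy (m σ t : ℝ) (q : Space p) :
    ‖Complex.exp (-Complex.I * σ * energy m q * t)‖ = 1 := by
  have : -Complex.I * σ * energy m q * t = ((-(σ * energy m q * t) : ℝ) : ℂ) * Complex.I := by
    push_cast
    ring
  rw [this, Complex.norm_exp_ofReal_mul_I]

lemma norm_amplitude_le (m : ℝ) {σ : ℝ} (hσ : σ = 1 ∨ σ = -1) (t : ℝ) (g : Space p → Spinor)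
    (q : Space p) : ‖amplitude m σ t g q‖ ≤ ‖g q‖ := by
  rw [amplitude, norm_smul, norm_exp_energy, one_mul]
  exact norm_projSymbol_apply_le m hσ q _

lemma aestronglyMeasurable_amplitude (m σ t : ℝ) {g : Space p → Spinor}
    (hg : AEStronglyMeasurable g (haar p)) : AEStronglyMeasurable (amplitude m σ t g) (haar p) := by
  have h1 := continuous_energy (p := p) m
  have h2 : Continuous fun q : Space p => Complex.exp (-Complex.I * σ * energy m q * t) := by
    fun_prop
  exact h2.aestronglyMeasurable.smul (aestronglyMeasurable_projSymbol_apply m σ hg)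

lemma integrable_amplitude (m : ℝ) {σ : ℝ} (hσ : σ = 1 ∨ σ = -1) (t : ℝ) {g : Space p → Spinor}
    (hg : Integrable g (haar p)) : Integrable (amplitude m σ t g) (haar p) :=
  hg.mono (aestronglyMeasurable_amplitude m σ t hg.aestronglyMeasurable)
    (Eventually.of_forall (norm_amplitude_le m hσ t g))

lemma memLp_amplitude (m : ℝ) {σ : ℝ} (hσ : σ = 1 ∨ σ = -1) (t : ℝ) {g : Space p → Spinor}
    (hg : MemLp g 2 (haar p)) : MemLp (amplitude m σ t g) 2 (haar p) :=
  hg.mono (aestronglyMeasurable_amplitude m σ t hg.aestronglyMeasurable)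
    (Eventually.of_forall (norm_amplitude_le m hσ t g))

lemma chi_mul_exp_smul (m σ t : ℝ) (g : Space p → Spinor) (x q : Space p) :
    (chi (-(x ⬝ᵥ q)) * Complex.exp (-Complex.I * σ * energy m q * t)) • projSymbol m σ q (g q) =
      chi (-x ⬝ᵥ q) • amplitude m σ t g q := by
  rw [amplitude, mul_smul, neg_dotProduct]

lemma expNegI_energyProj_ae (m : ℝ) {σ : ℝ} (hσ : σ = 1 ∨ σ = -1) (t : ℝ) {M : ℤ}
    {ψ : Space p → Spinor} (hψ : IsSchwartzBruhat M ψ) :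
    expNegI (hamiltonian p m) t (energyProj m σ (hψ.memLp.toLp ψ)) =ᵐ[haar p]
      fun x => fourier (amplitude m σ t (fourier ψ)) (-x) := by
  have hm := memLp_amplitude m hσ t hψ.fourier.memLp
  have h : fourierEquiv p (expNegI (hamiltonian p m) t (energyProj m σ (hψ.memLp.toLp ψ))) =
      hm.toLp _ := by
    refine Lp.ext (EventuallyEq.trans ?_ hm.coeFn_toLp.symm)
    filter_upwards [fourierEquiv_expNegI_ae m t (energyProj m σ (hψ.memLp.toLp ψ)),
      fourierEquiv_energyProj_ae m σ (hψ.memLp.toLp ψ), hψ.fourierEquiv_toLp_ae] with q h2 h3 h1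
    rw [h2, h3, h1, amplitude,
      expOp_apply_of_eigenvector (matOp_symbol_projSymbol m hσ q (fourier ψ q))]
    congr 2
    push_cast
    ring
  rw [← LinearIsometryEquiv.symm_apply_apply (fourierEquiv p)
    (expNegI (hamiltonian p m) t (energyProj m σ (hψ.memLp.toLp ψ))), h]
  exact fourierEquiv_symm_toLp hm (integrable_amplitude m hσ t hψ.fourier.integrable)

end Evolution

end PadicDirac

namespace PadicDirac

section Kernel

variable {p : ℕ} [Fact p.Prime]

/-! ### Integrability of exponentially decaying functions -/

/-- Multiplication by `p` maps each ball onto the next smaller one and scales Haar measure by a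
constant; the value of the constant is not needed. -/
lemma exists_haar_closedBall_eq_pow (p : ℕ) [Fact p.Prime] : ∃ c : NNReal, ∀ n : ℕ,
    haar p (Metric.closedBall 0 ((p : ℝ) ^ n)) = (c : ENNReal) ^ n := by
  have hp0 : (p : ℚ_[p]) ≠ 0 := by exact_mod_cast (Fact.out : p.Prime).ne_zero
  have hp1 : (0 : ℝ) < p := cast_prime_pos
  let e : Space p ≃L[ℚ_[p]] Space p :=
    ContinuousLinearEquiv.smulLeft (Units.mk0 (p : ℚ_[p]) hp0)
  have he : ∀ x, ‖e x‖ = (p : ℝ)⁻¹ * ‖x‖ := by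
    intro x
    change ‖(p : ℚ_[p]) • x‖ = _
    rw [norm_smul, Padic.norm_p]
  have hH : ((haar p).map e).IsAddHaarMeasure := e.isAddHaarMeasure_map _
  obtain ⟨c, hc⟩ : ∃ c : NNReal, (haar p).map e = c • haar p :=
    ⟨_, Measure.isAddLeftInvariant_eq_smul _ _⟩
  refine ⟨c, fun n => ?_⟩
  induction n with
  | zero => simp [haar_closedBall_zero_one]
  | succ n ih =>
    have h1 : Metric.closedBall (0 : Space p) ((p : ℝ) ^ (n + 1)) =
        e ⁻¹' Metric.closedBall 0 ((p : ℝ) ^ n) := by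
      ext x
      rw [Set.mem_preimage, mem_closedBall_zero_iff, mem_closedBall_zero_iff, he,
        inv_mul_le_iff₀ hp1, pow_succ, mul_comm]
    rw [h1, ← Measure.map_apply e.continuous.measurable Metric.isClosed_closedBall.measurableSet,
      hc, Measure.smul_apply, ih, pow_succ, mul_comm, ENNReal.smul_def, smul_eq_mul]

/-- Compare with a geometric series: `e^{-x} ≤ k!/x^k`, with `k` chosen so that `c < p^k`, gives
ratio `c/p^k < 1`. -/
lemma summable_pow_mul_exp (c : ℝ) {ε : ℝ} (hε : 0 < ε) (hc : 0 ≤ c) :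
    Summable fun n : ℕ => Real.exp (-(ε * (p : ℝ) ^ n)) * c ^ (n + 1) := by
  have hp1 : (1 : ℝ) < p := one_lt_cast_prime
  have hp0 : (0 : ℝ) < p := cast_prime_pos
  obtain ⟨k, hk⟩ := pow_unbounded_of_one_lt c hp1
  have hr : c / (p : ℝ) ^ k < 1 := (div_lt_one (by positivity)).mpr hk
  have hs := (summable_geometric_of_lt_one (by positivity) hr).mul_left
    (k.factorial / ε ^ k * c)
  refine hs.of_nonneg_of_le (fun n => by positivity) fun n => ?_
  have h1 := Real.pow_div_factorial_le_exp (ε * (p : ℝ) ^ n) (by positivity) k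
  have h2 : Real.exp (-(ε * (p : ℝ) ^ n)) ≤ k.factorial / (ε * (p : ℝ) ^ n) ^ k := by
    rw [Real.exp_neg, inv_le_comm₀ (Real.exp_pos _) (by positivity), inv_div]
    exact h1
  calc _ ≤ k.factorial / (ε * (p : ℝ) ^ n) ^ k * c ^ (n + 1) := by gcongr
    _ = _ := by
      rw [mul_pow, div_pow, pow_succ, ← pow_mul, ← pow_mul, mul_comm n k]
      field_simp

/-- Outside the unit ball, `q` lies in a shell `pⁿ ≤ ‖q‖ ≤ p^(n+1)`. There the function is at most
`e^{-εpⁿ}`, and the shell has volume at most that of its outer ball. -/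
lemma integrable_exp_neg_norm {ε : ℝ} (hε : 0 < ε) :
    Integrable (fun q : Space p => Real.exp (-(ε * ‖q‖))) (haar p) := by
  obtain ⟨c, hc⟩ := exists_haar_closedBall_eq_pow p
  have hcont : Continuous fun q : Space p => Real.exp (-(ε * ‖q‖)) := by fun_prop
  refine ⟨hcont.aestronglyMeasurable, ?_⟩
  rw [hasFiniteIntegral_iff_ofReal (Eventually.of_forall fun q => (Real.exp_pos _).le)]
  let a : ℕ → ENNReal := fun n => ENNReal.ofReal (Real.exp (-(ε * (p : ℝ) ^ n)))
  have hpt : ∀ q : Space p, ENNReal.ofReal (Real.exp (-(ε * ‖q‖))) ≤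
      (Metric.closedBall (0 : Space p) 1).indicator (fun _ => 1) q +
      ∑' n, (Metric.closedBall (0 : Space p) ((p : ℝ) ^ (n + 1))).indicator (fun _ => a n) q := by
    intro q
    by_cases hq : ‖q‖ ≤ 1
    · rw [Set.indicator_of_mem (by simpa using hq)]
      refine le_trans ?_ le_self_add
      rw [← ENNReal.ofReal_one]
      refine ENNReal.ofReal_le_ofReal (Real.exp_le_one_iff.mpr ?_)
      have := norm_nonneg q
      nlinarith
    · have hex : ∃ n : ℕ, ‖q‖ ≤ (p : ℝ) ^ n := by
        obtain ⟨n, hn⟩ := pow_unbounded_of_one_lt ‖q‖ (one_lt_cast_prime (p := p))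
        exact ⟨n, hn.le⟩
      obtain ⟨n, hn1, hn2⟩ : ∃ n : ℕ, ‖q‖ ≤ (p : ℝ) ^ (n + 1) ∧ (p : ℝ) ^ n ≤ ‖q‖ := by
        classical
        have hs := Nat.find_spec hex
        have hm := fun k => Nat.find_min (m := k) hex
        -- The least exponent is positive because `‖q‖ > 1`; its predecessor gives the inner radius.
        obtain ⟨n, hn⟩ : ∃ n, Nat.find hex = n + 1 := by
          refine Nat.exists_eq_succ_of_ne_zero fun h0 => hq ?_
          rw [h0] at hs
          simpa using hs
        rw [hn] at hs
        exact ⟨n, hs, (not_le.mp (hm n (by omega))).le⟩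
      refine le_trans ?_ le_add_self
      refine le_trans ?_ (ENNReal.le_tsum n)
      rw [Set.indicator_of_mem (by simpa using hn1)]
      refine ENNReal.ofReal_le_ofReal (Real.exp_le_exp.mpr ?_)
      nlinarith
  refine (lintegral_mono hpt).trans_lt ?_
  have hm : ∀ r : ℝ, MeasurableSet (Metric.closedBall (0 : Space p) r) :=
    fun r => Metric.isClosed_closedBall.measurableSet
  rw [lintegral_add_left (measurable_const.indicator (hm 1)),
    lintegral_tsum fun n => (measurable_const.indicator (hm _)).aemeasurable]
  simp only [lintegral_indicator_const (hm _), haar_closedBall_zero_one, hc]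
  refine ENNReal.add_lt_top.mpr ⟨by simp, ?_⟩
  have h1 : ∀ n, a n * (c : ENNReal) ^ (n + 1) =
      ENNReal.ofReal (Real.exp (-(ε * (p : ℝ) ^ n)) * (c : ℝ) ^ (n + 1)) := by
    intro n
    rw [ENNReal.ofReal_mul (Real.exp_pos _).le, ← NNReal.coe_pow, ENNReal.ofReal_coe_nnreal, ENNReal.coe_pow]
  simp only [h1]
  exact (summable_pow_mul_exp (c : ℝ) hε c.2).tsum_ofReal_lt_top

/-! ### The regularized kernel -/

variable {m σ t ε : ℝ}

lemma norm_exp_regularized (m σ t ε : ℝ) (q : Space p) :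
    ‖Complex.exp (-Complex.I * σ * energy m q * t - ε * energy m q)‖ =
      Real.exp (-(ε * energy m q)) := by
  rw [sub_eq_add_neg, Complex.exp_add, norm_mul, norm_exp_energy, one_mul, ← Complex.ofReal_mul,
    ← Complex.ofReal_neg, Complex.norm_exp_ofReal]

lemma energy_neg (m : ℝ) (q : Space p) : energy m (-q) = energy m q := by simp [energy]

/-- Only the norms `|q_k|` enter. This evenness permits the reflection that matches the kernel's
character with that of the inverse transform. -/
lemma projSymbol_neg (m σ : ℝ) (q : Space p) : projSymbol m σ (-q) = projSymbol m σ q := by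
  simp [projSymbol, energy_neg, symbol, alphaDot]

/-- The phase `χ_p(z · q) e^{-iσλ(q)t} e^{-ελ(q)}` of the regularized kernel. -/
noncomputable def regularizedPhase (m σ t ε : ℝ) (z q : Space p) : ℂ :=
  chi (z ⬝ᵥ q) * Complex.exp (-Complex.I * σ * energy m q * t - ε * energy m q)

lemma kernelIntegrand_eq (m σ t ε : ℝ) (z q : Space p) :
    kernelIntegrand m σ t ε z q = regularizedPhase m σ t ε z q • projSymbol m σ q := rfl

lemma norm_regularizedPhase (m σ t ε : ℝ) (z q : Space p) :
    ‖regularizedPhase m σ t ε z q‖ = Real.exp (-(ε * energy m q)) := by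
  rw [regularizedPhase, norm_mul, norm_chi, one_mul, norm_exp_regularized]

lemma continuous_regularizedPhase (m σ t ε : ℝ) {X : Type*} [TopologicalSpace X]
    {f g : X → Space p} (hf : Continuous f) (hg : Continuous g) :
    Continuous fun x => regularizedPhase m σ t ε (f x) (g x) := by
  have h1 : Continuous fun x => energy m (g x) := (continuous_energy (p := p) m).comp hg
  have h2 : Continuous fun x => chi (f x ⬝ᵥ g x) := continuous_chi.comp (by fun_prop)
  unfold regularizedPhase
  fun_prop

lemma regularizedPhase_sub_neg (m σ t ε : ℝ) (x y q : Space p) :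
    regularizedPhase m σ t ε (x - y) (-q) = regularizedPhase m σ t ε (-x) q * chi (q ⬝ᵥ y) := by
  rw [regularizedPhase, regularizedPhase, energy_neg, dotProduct_neg, sub_dotProduct, neg_sub,
    sub_eq_add_neg, chi_add, dotProduct_comm y, neg_dotProduct]
  ring

lemma norm_kernelIntegrand_le (hσ : σ = 1 ∨ σ = -1) (hε : 0 < ε) (z q : Space p) :
    ‖kernelIntegrand m σ t ε z q‖ ≤ Real.exp (-(ε * ‖q‖)) := by
  rw [kernelIntegrand_eq, norm_smul, norm_regularizedPhase]
  calc _ ≤ Real.exp (-(ε * energy m q)) * 1 := by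
        gcongr
        exact norm_projSymbol_le m hσ q
    _ ≤ _ := by
        rw [mul_one]
        gcongr
        exact norm_le_energy m q

lemma aestronglyMeasurable_kernelIntegrand (m σ t ε : ℝ) (z : Space p) :
    AEStronglyMeasurable (kernelIntegrand m σ t ε z) (haar p) :=
  (continuous_regularizedPhase m σ t ε continuous_const continuous_id).aestronglyMeasurable.smul
    (aestronglyMeasurable_projSymbol m σ)

lemma integrable_kernelIntegrand (hσ : σ = 1 ∨ σ = -1) (hε : 0 < ε) (z : Space p) :
    Integrable (kernelIntegrand m σ t ε z) (haar p) :=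
  (integrable_exp_neg_norm hε).mono' (aestronglyMeasurable_kernelIntegrand m σ t ε z)
    (Eventually.of_forall (norm_kernelIntegrand_le hσ hε z))

lemma continuous_integral_kernelIntegrand (hσ : σ = 1 ∨ σ = -1) (hε : 0 < ε) :
    Continuous fun z : Space p => ∫ q, kernelIntegrand m σ t ε z q ∂(haar p) := by
  refine continuous_of_dominated (aestronglyMeasurable_kernelIntegrand m σ t ε)
    (fun z => Eventually.of_forall (norm_kernelIntegrand_le hσ hε z))
    (integrable_exp_neg_norm hε) (Eventually.of_forall fun q => ?_)
  exact (continuous_regularizedPhase m σ t ε continuous_id continuous_const).smul continuous_const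

lemma integrable_kernel_apply (hσ : σ = 1 ∨ σ = -1) (hε : 0 < ε) {M : ℤ} {ψ : Space p → Spinor}
    (hψ : IsSchwartzBruhat M ψ) (x : Space p) :
    Integrable (fun y => (∫ q, kernelIntegrand m σ t ε (x - y) q ∂(haar p)) (ψ y)) (haar p) := by
  have hc : Continuous fun y => (∫ q, kernelIntegrand m σ t ε (x - y) q ∂(haar p)) (ψ y) :=
    ((continuous_integral_kernelIntegrand hσ hε).comp (continuous_sub_left x)).clm_apply
      hψ.continuous
  exact hc.integrable_of_hasCompactSupport
    (hψ.hasCompactSupport.mono fun y hy h => hy (by simp [h]))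

/-- The regularized kernel integral in momentum space. -/
lemma integral_kernel_apply (hσ : σ = 1 ∨ σ = -1) (hε : 0 < ε) {M : ℤ} {ψ : Space p → Spinor}
    (hψ : IsSchwartzBruhat M ψ) (x : Space p) :
    ∫ y, (∫ q, kernelIntegrand m σ t ε (x - y) q ∂(haar p)) (ψ y) ∂(haar p) =
      ∫ q, regularizedPhase m σ t ε (-x) q • projSymbol m σ q (fourier ψ q) ∂(haar p) := by
  have h1 : ∀ y, (∫ q, kernelIntegrand m σ t ε (x - y) q ∂(haar p)) (ψ y) =
      ∫ q, kernelIntegrand m σ t ε (x - y) q (ψ y) ∂(haar p) := fun y =>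
    ContinuousLinearMap.integral_apply (integrable_kernelIntegrand hσ hε (x - y)) (ψ y)
  simp only [h1]
  have hint : Integrable (Function.uncurry fun y q : Space p =>
      kernelIntegrand m σ t ε (x - y) q (ψ y)) ((haar p).prod (haar p)) := by
    have hb : Integrable (fun z : Space p × Space p => ‖ψ z.1‖ * Real.exp (-(ε * ‖z.2‖)))
        ((haar p).prod (haar p)) := hψ.integrable.norm.mul_prod (integrable_exp_neg_norm hε)
    refine hb.mono' ?_ (Eventually.of_forall fun z => ?_)
    · have hs : Continuous fun z : Space p × Space p => regularizedPhase m σ t ε (x - z.1) z.2 :=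
        continuous_regularizedPhase m σ t ε (continuous_const.sub continuous_fst) continuous_snd
      have hP : AEStronglyMeasurable (fun z : Space p × Space p => projSymbol m σ z.2 (ψ z.1))
          ((haar p).prod (haar p)) :=
        isBoundedBilinearMap_apply.continuous.comp_aestronglyMeasurable
          ((aestronglyMeasurable_projSymbol m σ).comp_snd.prodMk
            hψ.continuous.aestronglyMeasurable.comp_fst)
      exact hs.aestronglyMeasurable.smul hP
    · rw [mul_comm]
      exact (ContinuousLinearMap.le_opNorm _ _).trans
        (mul_le_mul_of_nonneg_right (norm_kernelIntegrand_le hσ hε _ _) (norm_nonneg _))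
  -- After Fubini, `q ↦ -q` turns `χ((x-y)·q)` into `χ(-x·q) χ(q·y)`, whose second factor produces
  -- `ψ̂(q)`.
  rw [integral_integral_swap hint, ← integral_neg_eq_self]
  congr 1
  funext q
  have h2 : ∀ y, kernelIntegrand m σ t ε (x - y) (-q) (ψ y) =
      regularizedPhase m σ t ε (-x) q • projSymbol m σ q (chi (q ⬝ᵥ y) • ψ y) := by
    intro y
    rw [kernelIntegrand_eq, regularizedPhase_sub_neg, projSymbol_neg, _root_.map_smul, smul_smul]
    rfl
  simp only [h2]
  rw [integral_smul, ContinuousLinearMap.integral_comp_comm _ (integrable_chi_smul hψ.integrable q),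
    fourier]

/-- The majorant is `‖g‖`, since `e^{-ελ} ≤ 1` for `ε > 0` and `Π_σ` is a contraction; the integrand
is continuous in `ε` down to `0`. -/
lemma tendsto_integral_regularized (hσ : σ = 1 ∨ σ = -1) {g : Space p → Spinor}
    (hg : Integrable g (haar p)) (x : Space p) :
    Tendsto (fun ε : ℝ => ∫ q, regularizedPhase m σ t ε (-x) q • projSymbol m σ q (g q) ∂(haar p))
      (𝓝[>] 0) (𝓝 (∫ q, chi (-x ⬝ᵥ q) • amplitude m σ t g q ∂(haar p))) := by
  refine tendsto_integral_filter_of_dominated_convergence (fun q => ‖g q‖)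
    (Eventually.of_forall fun ε => ?_) ?_ hg.norm (Eventually.of_forall fun q => ?_)
  · have hs : Continuous fun q : Space p => regularizedPhase m σ t ε (-x) q :=
      continuous_regularizedPhase m σ t ε continuous_const continuous_id
    exact hs.aestronglyMeasurable.smul
      (aestronglyMeasurable_projSymbol_apply m σ hg.aestronglyMeasurable)
  · filter_upwards [self_mem_nhdsWithin] with ε hε
    refine Eventually.of_forall fun q => ?_
    rw [norm_smul, norm_regularizedPhase]
    have h1 : Real.exp (-(ε * energy m q)) ≤ 1 := by
      rw [Real.exp_le_one_iff, neg_nonpos]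
      exact mul_nonneg (le_of_lt hε) (energy_nonneg m q)
    calc _ ≤ 1 * ‖g q‖ :=
          mul_le_mul h1 (norm_projSymbol_apply_le m hσ q _) (norm_nonneg _) zero_le_one
      _ = _ := one_mul _
  · have hc : Continuous fun ε : ℝ => regularizedPhase m σ t ε (-x) q := by
      unfold regularizedPhase
      fun_prop
    have h := (hc.tendsto 0).smul_const (projSymbol m σ q (g q))
    have h0 : regularizedPhase m σ t 0 (-x) q • projSymbol m σ q (g q) =
        chi (-x ⬝ᵥ q) • amplitude m σ t g q := by
      rw [regularizedPhase, amplitude, Complex.ofReal_zero, zero_mul, sub_zero, mul_smul]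
    rw [h0] at h
    exact h.mono_left nhdsWithin_le_nhds

lemma exists_isSchwartzBruhat_of_isLizorkin {ψ : Space p → Spinor}
    (hψ : ∀ i, IsLizorkin fun x => ψ x i) : ∃ M, IsSchwartzBruhat M ψ := by
  refine isSchwartzBruhat_of_isLocallyConstant ?_ ?_
  · refine (IsLocallyConstant.iff_eventually_eq _).mpr fun x => ?_
    have h := eventually_all.mpr fun i =>
      (IsLocallyConstant.iff_eventually_eq _).mp (hψ i).locallyConstant x
    filter_upwards [h] with y hy
    ext i
    exact hy i
  · refine HasCompactSupport.intro
      (isCompact_iUnion fun i : Fin 4 => (hψ i).compactSupport.isCompact) fun x hx => ?_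
    ext i
    exact image_eq_zero_of_notMem_tsupport (f := fun x => ψ x i)
      fun h => hx (Set.mem_iUnion.mpr ⟨i, h⟩)

end Kernel

end PadicDirac

/-! ### The evolution formula and its regularized kernel form -/

theorem theorem4 (p : ℕ) [Fact p.Prime] (m σ t : ℝ) (hσ : σ = 1 ∨ σ = -1)
    (ψ : PadicDirac.Space p → PadicDirac.Spinor)
    (hψ : ∀ i, PadicDirac.IsLizorkin fun x => ψ x i) :
    -- the momentum integral converges absolutely at every point and represents the evolved state
    (∀ x : PadicDirac.Space p, Integrable (fun q : PadicDirac.Space p =>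
        (PadicDirac.chi (-(x ⬝ᵥ q)) *
            Complex.exp (-Complex.I * σ * PadicDirac.energy m q * t)) •
          PadicDirac.projSymbol m σ q (PadicDirac.fourier ψ q)) (PadicDirac.haar p)) ∧
    (PadicDirac.expNegI (PadicDirac.hamiltonian p m) t
        (PadicDirac.energyProj m σ ((PadicDirac.memLp_of_isLizorkin hψ).toLp ψ))
      =ᵐ[PadicDirac.haar p] fun x => ∫ q,
        (PadicDirac.chi (-(x ⬝ᵥ q)) *
            Complex.exp (-Complex.I * σ * PadicDirac.energy m q * t)) •
          PadicDirac.projSymbol m σ q (PadicDirac.fourier ψ q) ∂(PadicDirac.haar p)) ∧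
    -- the regularized kernel integrals converge absolutely
    (∀ ε > 0, ∀ z : PadicDirac.Space p,
      Integrable (PadicDirac.kernelIntegrand m σ t ε z) (PadicDirac.haar p)) ∧
    (∀ ε > 0, ∀ x : PadicDirac.Space p, Integrable (fun y =>
      (∫ q, PadicDirac.kernelIntegrand m σ t ε (x - y) q ∂(PadicDirac.haar p)) (ψ y))
        (PadicDirac.haar p)) ∧
    -- and tend, at every point, to the momentum integral
    (∀ x : PadicDirac.Space p, Tendsto
      (fun ε : ℝ => ∫ y,
        (∫ q, PadicDirac.kernelIntegrand m σ t ε (x - y) q ∂(PadicDirac.haar p)) (ψ y)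
          ∂(PadicDirac.haar p))
      (𝓝[>] 0)
      (𝓝 (∫ q,
        (PadicDirac.chi (-(x ⬝ᵥ q)) *
            Complex.exp (-Complex.I * σ * PadicDirac.energy m q * t)) •
          PadicDirac.projSymbol m σ q (PadicDirac.fourier ψ q) ∂(PadicDirac.haar p)))) := by
  obtain ⟨M, hM⟩ := PadicDirac.exists_isSchwartzBruhat_of_isLizorkin hψ
  refine ⟨fun x => ?_, ?_, fun ε hε z => PadicDirac.integrable_kernelIntegrand hσ hε z,
    fun ε hε x => PadicDirac.integrable_kernel_apply hσ hε hM x, fun x => ?_⟩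
  · simp only [PadicDirac.chi_mul_exp_smul]
    exact PadicDirac.integrable_chi_smul
      (PadicDirac.integrable_amplitude m hσ t hM.fourier.integrable) (-x)
  · simp only [PadicDirac.chi_mul_exp_smul]
    exact PadicDirac.expNegI_energyProj_ae m hσ t hM
  · simp only [PadicDirac.chi_mul_exp_smul]
    -- The kernel and momentum integrals agree only for `ε > 0`, which suffices for a one-sided
    -- limit.
    refine (PadicDirac.tendsto_integral_regularized hσ hM.fourier.integrable x).congr' ?_
    filter_upwards [self_mem_nhdsWithin] with ε hε
    exact (PadicDirac.integral_kernel_apply hσ hε hM x).symm
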